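/- Let $G$ be a finite group, and let $\hat H^i(G,-)$, $i\in\mathbb Z$, denote Tate cohomology. For $G$-modules $X, Y$ let $\mathrm{Hom}(X,Y)=\mathrm{Hom}_{\mathbb Z}(X,Y)$ with the action $(gf)(x)=g\,f(g^{-1}x)$, and let $[\mathrm{id}_X]\in\hat H^0(G,\mathrm{Hom}(X,X))$ be the class of the identity of $X$. For $a\in\hat H^p(G,\mathrm{Hom}(Y,Z))$ and $x\in\hat H^q(G,\mathrm{Hom}(X,Y))$ let $a\cup x\in\hat H^{p+q}(G,\mathrm{Hom}(X,Z))$ be the cup product followed by the map induced by composition $\mathrm{Hom}(Y,Z)\otimes\mathrm{Hom}(X,Y)\to\mathrm{Hom}(X,Z)$, $f\otimes\varphi\mapsto f\circ\varphi$. For $r\in\mathbb Z$, a pair $(X,X')$ of $G$-modules is called an $r$-encoding pair if for some $i\in\mathbb Z$ there is an isomorphism $\hat H^i(G,\mathrm{Hom}(X,-))\cong\hat H^{i+r}(G,\mathrm{Hom}(X',-))$ of functors on the category of $G$-modules. **Proposition.** Let $X$ and $X'$ be $G$-modules and let $r\in\mathbb Z$. The following are equivalent. (a) $(X,X')$ is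 an $r$-encoding pair. (b) There is an $x\in\hat H^r(G,\mathrm{Hom}(X',X))$ such that for every $i\in\mathbb Z$ the maps $a\mapsto a\cup x$ form a natural isomorphism $\hat H^i(G,\mathrm{Hom}(X,-))\to\hat H^{i+r}(G,\mathrm{Hom}(X',-))$. (c) There are $x\in\hat H^r(G,\mathrm{Hom}(X',X))$ and $x'\in\hat H^{-r}(G,\mathrm{Hom}(X,X'))$ such that $x'\cup x=[\mathrm{id}_{X'}]$ in $\hat H^0(G,\mathrm{Hom}(X',X'))$ and $x\cup x'=[\mathrm{id}_X]$ in $\hat H^0(G,\mathrm{Hom}(X,X))$. -/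

import Mathlib

open CategoryTheory groupCohomology groupHomology

noncomputable section

namespace TateCup

universe u

/-!
Throughout, a `G`-module over a commutative ring `k` is an object of `Rep k G` (for `k = ℤ` these
are the usual `G`-modules), and Tate cohomology is Mathlib's `tateCohomology`.

The cup product on Tate cohomology is built by dimension shifting in the first variable: in
degree `(0, q)` it is `[a] ∪ y = (a ⊗ -)_* y`, and it is extended to all degrees of the first
variable by the rule `δ a ∪ y = δ (a ∪ y)` for the two short exact sequences
`0 ⟶ A ⟶ k[G] ⊗ A ⟶ (k[G]/k N) ⊗ A ⟶ 0` and `0 ⟶ I_G ⊗ A ⟶ k[G] ⊗ A ⟶ A ⟶ 0`, whose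
connecting maps are isomorphisms because `k[G] ⊗ A` is induced.
-/

variable {k G : Type u} [CommRing k] [Group G] [Fintype G]

/-! ### Norm maps act as zero on Tate cohomology

If `f = ∑ g, g ∘ φ ∘ g⁻¹` for a `k`-linear map `φ`, then `f` is null-homotopic on Tate complexes. -/

/-- The null-homotopy on inhomogeneous cochains. -/
def cochainContraction {A B : Rep k G} (φ : A.V →ₗ[k] B.V) (n : ℕ) :
    ((Fin (n + 1) → G) → A.V) →ₗ[k] ((Fin n → G) → B.V) where
  toFun c γ := ∑ g : G, B.ρ g (φ (c (Fin.cons g⁻¹ γ)))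
  map_add' c c' := by ext; simp [Finset.sum_add_distrib]
  map_smul' r c := by ext; simp [Finset.smul_sum]

/-- The null-homotopy on inhomogeneous chains. -/
def chainContraction {A B : Rep k G} (φ : A.V →ₗ[k] B.V) (n : ℕ) :
    ((Fin n → G) →₀ A.V) →ₗ[k] ((Fin (n + 1) → G) →₀ B.V) :=
  Finsupp.lsum k fun γ => ∑ g : G, Finsupp.lsingle (Fin.cons g γ : Fin (n + 1) → G) ∘ₗ φ ∘ₗ A.ρ g

/-- The null-homotopy from degree `0` to degree `-1`. -/
def connectContraction {A B : Rep k G} (φ : A.V →ₗ[k] B.V) :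
    ((Fin 0 → G) → A.V) →ₗ[k] ((Fin 0 → G) →₀ B.V) where
  toFun c := Finsupp.single default (φ (c default))
  map_add' c c' := by simp
  map_smul' r c := by simp

theorem contractNth_cons_zero {n : ℕ} (g : G) (γ : Fin (n + 1) → G) :
    Fin.contractNth (0 : Fin (n + 2)) (· * ·) (Fin.cons g γ : Fin (n + 2) → G)
      = Fin.cons (g * γ 0) (fun i => γ i.succ) := by
  ext i
  refine Fin.cases ?_ (fun i => ?_) i <;> simp [Fin.contractNth]

theorem contractNth_cons_succ {n : ℕ} (g : G) (γ : Fin (n + 1) → G) (j : Fin (n + 1)) :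
    Fin.contractNth j.succ (· * ·) (Fin.cons g γ : Fin (n + 2) → G)
      = Fin.cons g (Fin.contractNth j (· * ·) γ) := by
  ext i
  refine Fin.cases ?_ (fun i => ?_) i <;> simp [Fin.contractNth]

section

variable {A B : Rep k G} (f : A ⟶ B) (φ : A.V →ₗ[k] B.V)

theorem cochain_homotopy_succ
    (hf : ∀ a, f.hom a = ∑ g : G, B.ρ g (φ (A.ρ g⁻¹ a))) (n : ℕ)
    (c : (Fin (n + 1) → G) → A.V) (γ : Fin (n + 1) → G) :
    f.hom (c γ) = cochainContraction φ (n + 1) ((inhomogeneousCochains.d A (n + 1)).hom c) γ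
      + (inhomogeneousCochains.d B n).hom (cochainContraction φ n c) γ := by
  have e2 : ∑ g : G, B.ρ (γ 0) (B.ρ g (φ (c (Fin.cons g⁻¹ fun i => γ i.succ)))) =
      ∑ g : G, B.ρ g (φ (c (Fin.cons (g⁻¹ * γ 0) fun i => γ i.succ))) := by
    refine Fintype.sum_equiv (Equiv.mulLeft (γ 0)) _ _ fun g => ?_
    simp [mul_assoc]
  rw [hf]
  simp only [inhomogeneousCochains.d_hom_apply, cochainContraction, LinearMap.coe_mk, AddHom.coe_mk]
  simp only [Fin.sum_univ_succ (n := n + 1), contractNth_cons_succ, contractNth_cons_zero,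
    Fin.cons_zero, Fin.cons_succ, map_add, map_sum, Finset.sum_add_distrib, e2]
  rw [Finset.sum_comm (s := Finset.univ (α := G)) (t := Finset.univ (α := Fin (n + 1)))]
  simp only [map_smul, Fin.val_succ, pow_succ (-1 : k) (_ + 1), mul_neg, mul_one,
    neg_smul, Finset.smul_sum]
  simp
  abel

theorem cochain_homotopy_zero
    (hf : ∀ a, f.hom a = ∑ g : G, B.ρ g (φ (A.ρ g⁻¹ a)))
    (c : (Fin 0 → G) → A.V) (γ : Fin 0 → G) :
    f.hom (c γ) = cochainContraction φ 0 ((inhomogeneousCochains.d A 0).hom c) γ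
      + B.tateNorm.hom (connectContraction φ c) γ := by
  have e : ∀ γ' : Fin 0 → G, c γ' = c default := fun γ' => by rw [Subsingleton.elim γ' default]
  rw [hf, Rep.tateNorm_eq]
  simp [inhomogeneousCochains.d_hom_apply, cochainContraction, connectContraction,
    Representation.norm, Finset.sum_add_distrib, e]

theorem chainContraction_single (n : ℕ) (γ : Fin n → G) (a : A.V) :
    chainContraction φ n (Finsupp.single γ a) =
      ∑ g : G, Finsupp.single (Fin.cons g γ : Fin (n + 1) → G) (φ (A.ρ g a)) := by
  simp [chainContraction]

/-- The differential of inhomogeneous chains, as a linear map. -/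
def chainD (A : Rep k G) (n : ℕ) : ((Fin (n + 1) → G) →₀ A.V) →ₗ[k] ((Fin n → G) →₀ A.V) :=
  (inhomogeneousChains.d A n).hom

theorem chainD_single (n : ℕ) (γ : Fin (n + 1) → G) (a : A.V) :
    chainD A n (Finsupp.single γ a) =
      Finsupp.single (fun i => γ i.succ) (A.ρ (γ 0)⁻¹ a) +
        ∑ j : Fin (n + 1), (-1 : k) ^ ((j : ℕ) + 1) • Finsupp.single (Fin.contractNth j (· * ·) γ) a :=
  inhomogeneousChains.d_single n γ a

theorem chain_homotopy_zero
    (hf : ∀ a, f.hom a = ∑ g : G, B.ρ g (φ (A.ρ g⁻¹ a))) (γ : Fin 0 → G) (a : A.V) :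
    Finsupp.single γ (f.hom a) = connectContraction φ (A.tateNorm.hom (Finsupp.single γ a)) +
      chainD B 0 (chainContraction φ 0 (Finsupp.single γ a)) := by
  have e : ∀ (γ' : Fin 0 → G) (b : B.V), Finsupp.single γ' b = Finsupp.single γ b :=
    fun γ' b => by rw [Subsingleton.elim γ' γ]
  rw [hf, Rep.tateNorm_eq, chainContraction_single, map_sum]
  simp only [chainD_single, connectContraction]
  simp [Representation.norm, Finset.sum_add_distrib, e, ← Finsupp.single_finsetSum]
  exact Fintype.sum_equiv (Equiv.inv G) _ _ fun g => by simp

theorem chain_homotopy_succ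
    (hf : ∀ a, f.hom a = ∑ g : G, B.ρ g (φ (A.ρ g⁻¹ a))) (n : ℕ) (γ : Fin (n + 1) → G) (a : A.V) :
    Finsupp.single γ (f.hom a) =
      chainContraction φ n (chainD A n (Finsupp.single γ a)) +
      chainD B (n + 1) (chainContraction φ (n + 1) (Finsupp.single γ a)) := by
  rw [hf]
  have e2 : ∑ g : G, Finsupp.single (Fin.cons g (fun i => γ i.succ) : Fin (n + 1) → G)
      (φ (A.ρ g (A.ρ (γ 0)⁻¹ a))) =
      ∑ g : G, Finsupp.single (Fin.cons (g * γ 0) (fun i => γ i.succ) : Fin (n + 1) → G)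
        (φ (A.ρ g a)) := by
    refine (Fintype.sum_equiv (Equiv.mulRight (γ 0)) _ _ fun g => ?_).symm
    simp
  have e3 : ∑ g : G, Finsupp.single γ (B.ρ g⁻¹ (φ (A.ρ g a))) =
      Finsupp.single γ (∑ g : G, B.ρ g (φ (A.ρ g⁻¹ a))) := by
    rw [Finsupp.single_finsetSum]
    exact Fintype.sum_equiv (Equiv.inv G) _ _ fun g => by simp
  rw [chainContraction_single, map_sum]
  simp only [chainD_single, map_add, map_sum, map_smul, chainContraction_single, e2,
    Fin.sum_univ_succ (n := n + 1), contractNth_cons_succ, contractNth_cons_zero,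
    Fin.cons_zero, Fin.cons_succ, Finset.sum_add_distrib, e3]
  rw [Finset.sum_comm (s := Finset.univ (α := G)) (t := Finset.univ (α := Fin (n + 1)))]
  simp only [Fin.val_succ, pow_succ (-1 : k) (_ + 1), mul_neg, mul_one,
    neg_smul, Finset.sum_neg_distrib, Finset.smul_sum]
  simp
  abel

/-- The null-homotopy on the Tate complex. -/
def contractionHom : ∀ i j : ℤ, (tateComplex A).X i ⟶ (tateComplex B).X j
  | .ofNat n, .ofNat m =>
    if h : n = m + 1 then ModuleCat.ofHom (by subst h; exact cochainContraction φ m) else 0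
  | .negSucc n, .negSucc m =>
    if h : m = n + 1 then ModuleCat.ofHom (by subst h; exact chainContraction φ n) else 0
  | .ofNat n, .negSucc m =>
    if hn : n = 0 then if hm : m = 0 then
      ModuleCat.ofHom (by subst hn hm; exact connectContraction φ) else 0 else 0
  | .negSucc _, .ofNat _ => 0

theorem contractionHom_ofNat (n : ℕ) :
    contractionHom φ (.ofNat (n + 1)) (.ofNat n) = ModuleCat.ofHom (cochainContraction φ n) := by
  simp [contractionHom]
  rfl

theorem contractionHom_negSucc (n : ℕ) :
    contractionHom φ (.negSucc n) (.negSucc (n + 1)) = ModuleCat.ofHom (chainContraction φ n) := by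
  simp [contractionHom]
  rfl

theorem contractionHom_zero :
    contractionHom φ (.ofNat 0) (.negSucc 0) = ModuleCat.ofHom (connectContraction φ) := by
  simp [contractionHom]
  rfl

theorem tateComplex_d_ofNat' (n : ℕ) : (tateComplex A).d (.ofNat n) (.ofNat (n + 1)) =
    inhomogeneousCochains.d A n := inhomogeneousCochains.d_def A n

theorem tateComplex_d_negSucc' (n : ℕ) : (tateComplex A).d (.negSucc (n + 1)) (.negSucc n) =
    inhomogeneousChains.d A n := by
  rw [← inhomogeneousChains.d_def A n]
  rfl

/-- The map of Tate complexes induced by `∑ g, g ∘ φ ∘ g⁻¹` is null-homotopic. -/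
def contraction (hf : ∀ a, f.hom a = ∑ g : G, B.ρ g (φ (A.ρ g⁻¹ a))) :
    Homotopy (tateComplex.map f) 0 where
  hom := contractionHom φ
  zero i j hij := by
    match i, j with
    | .ofNat n, .ofNat m =>
      have : n ≠ m + 1 := by rintro rfl; simp at hij
      simp [contractionHom, this]
    | .negSucc n, .negSucc m =>
      have : m ≠ n + 1 := by rintro rfl; apply hij; simp; omega
      simp [contractionHom, this]
    | .ofNat n, .negSucc m => 
      have : n = 0 → m ≠ 0 := by rintro rfl rfl; simp at hij
      by_cases hn : n = 0 <;> simp [contractionHom, hn, this]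
    | .negSucc _, .ofNat _ => rfl
  comm i := by
    match i with
    | .ofNat 0 =>
      rw [dNext_eq (c := ComplexShape.up ℤ) (i := Int.ofNat 0) (i' := Int.ofNat 1) _ rfl,
        prevD_eq (c := ComplexShape.up ℤ) (j := Int.ofNat 0) (j' := Int.negSucc 0) _ rfl,
        contractionHom_ofNat, contractionHom_zero, tateComplex_d_ofNat']
      ext c
      exact funext fun γ => (cochain_homotopy_zero f φ hf c γ).trans (add_zero _).symm
    | .ofNat (n + 1) =>
      rw [dNext_eq (c := ComplexShape.up ℤ) (i := Int.ofNat (n + 1)) (i' := Int.ofNat (n + 2)) _ rfl,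
        prevD_eq (c := ComplexShape.up ℤ) (j := Int.ofNat (n + 1)) (j' := Int.ofNat n) _ rfl,
        contractionHom_ofNat, contractionHom_ofNat, tateComplex_d_ofNat', tateComplex_d_ofNat']
      ext c
      exact funext fun γ => (cochain_homotopy_succ f φ hf n c γ).trans (add_zero _).symm
    | .negSucc 0 =>
      rw [dNext_eq (c := ComplexShape.up ℤ) (i := Int.negSucc 0) (i' := Int.ofNat 0) _ rfl,
        prevD_eq (c := ComplexShape.up ℤ) (j := Int.negSucc 0) (j' := Int.negSucc 1) _ rfl,
        contractionHom_zero, contractionHom_negSucc, tateComplex_d_negSucc']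
      refine inhomogeneousChains.ext fun γ => ?_
      ext a
      refine Eq.trans (chainsMap_f_single (MonoidHom.id G) f 0 γ a)
        ((chain_homotopy_zero f φ hf γ a).trans (add_zero _).symm)
    | .negSucc (n + 1) =>
      rw [dNext_eq (c := ComplexShape.up ℤ) (i := Int.negSucc (n + 1)) (i' := Int.negSucc n) _ rfl,
        prevD_eq (c := ComplexShape.up ℤ) (j := Int.negSucc (n + 1)) (j' := Int.negSucc (n + 2)) _
          rfl,
        contractionHom_negSucc, contractionHom_negSucc, tateComplex_d_negSucc',
        tateComplex_d_negSucc']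
      refine inhomogeneousChains.ext fun γ => ?_
      ext a
      refine Eq.trans (chainsMap_f_single (MonoidHom.id G) f (n + 1) γ a)
        ((chain_homotopy_succ f φ hf n γ a).trans (add_zero _).symm)

theorem map_eq_zero_of_norm (hf : ∀ a, f.hom a = ∑ g : G, B.ρ g (φ (A.ρ g⁻¹ a))) (n : ℤ) :
    (tateCohomologyFunctor n).map f = 0 :=
  ((contraction f φ hf).homologyMap_eq n).trans (HomologicalComplex.homologyMap_zero _ _ n)
end

/-! ### The dimension shifting isomorphisms -/

open MonoidalCategory

/-- The augmentation `k[G] ⟶ k`, `g ↦ 1`. -/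
def aug (k G : Type u) [CommRing k] [Group G] : Rep.leftRegular k G ⟶ 𝟙_ (Rep k G) :=
  Rep.leftRegularHom (𝟙_ (Rep k G)) (1 : k)

/-- The map `k ⟶ k[G]`, `1 ↦ N = ∑ g, g`. -/
def normElt (k G : Type u) [CommRing k] [Group G] [Fintype G] :
    𝟙_ (Rep k G) ⟶ Rep.leftRegular k G :=
  Rep.ofHom ⟨∑ g : G, MonoidAlgebra.lsingle (R := k) g, fun g => by
    ext : 1
    simp only [Rep.tensorUnit_ρ, LinearMap.comp_apply, LinearMap.sum_apply, map_sum,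
      MonoidAlgebra.lsingle_apply, Representation.ofMulAction_single, smul_eq_mul,
      Representation.isTrivial_apply]
    exact (Fintype.sum_equiv (Equiv.mulLeft g) _ _ fun h => rfl).symm⟩

/-- The augmentation ideal `I_G`, as a `G`-module. -/
def augKer (k G : Type u) [CommRing k] [Group G] : Rep k G :=
  Rep.subrepresentation (Rep.leftRegular k G) (LinearMap.ker (aug k G).hom.toLinearMap) fun g x hx => by
    exact (Rep.hom_comm_apply (aug k G) g x).trans hx

/-- The quotient `k[G]/k N` of `k[G]` by the span of the norm element. -/
def normCoker (k G : Type u) [CommRing k] [Group G] [Fintype G] : Rep k G :=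
  Rep.quotient (Rep.leftRegular k G) (LinearMap.range (normElt k G).hom.toLinearMap) fun g x hx => by
    obtain ⟨r, rfl⟩ := hx
    exact ⟨r, Rep.hom_comm_apply (normElt k G) g r⟩

/-- The sequence `I_G ⟶ k[G] ⟶ k`. -/
def downSeq (k G : Type u) [CommRing k] [Group G] : ShortComplex (Rep k G) where
  X₁ := augKer k G
  X₂ := Rep.leftRegular k G
  X₃ := 𝟙_ (Rep k G)
  f := Rep.subtype _ _ _
  g := aug k G
  zero := by
    ext x
    exact x.2

/-- The sequence `k ⟶ k[G] ⟶ k[G]/k N`. -/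
def upSeq (k G : Type u) [CommRing k] [Group G] [Fintype G] : ShortComplex (Rep k G) where
  X₁ := 𝟙_ (Rep k G)
  X₂ := Rep.leftRegular k G
  X₃ := normCoker k G
  f := normElt k G
  g := Rep.mkQ _ _ _
  zero := by
    ext x
    exact (Submodule.Quotient.mk_eq_zero _).2 ⟨_, rfl⟩

/-- A `k`-split sequence stays short exact after tensoring. -/
theorem tensor_shortExact (S : ShortComplex (Rep k G)) (r : S.X₂.V →ₗ[k] S.X₁.V)
    (s : S.X₃.V →ₗ[k] S.X₂.V) (hr : ∀ x, r (S.f.hom x) = x) (hs : ∀ x, S.g.hom (s x) = x)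
    (hrs : ∀ x, S.f.hom (r x) + s (S.g.hom x) = x) (M : Rep k G) :
    (S.map (tensorRight M)).ShortExact := by
  refine ShortExact.reflects_shortExact_of_faithful (forget₂ (Rep k G) (ModuleCat k))
    (ShortComplex.Splitting.shortExact
      { r := ModuleCat.ofHom (r.rTensor M.V)
        s := ModuleCat.ofHom (s.rTensor M.V)
        f_r := ?_
        s_g := ?_
        id := ?_ })
  · refine ModuleCat.hom_ext (TensorProduct.ext' fun x m => ?_)
    exact congrArg (fun y => TensorProduct.tmul k y m) (hr x)
  · refine ModuleCat.hom_ext (TensorProduct.ext' fun x m => ?_)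
    exact congrArg (fun y => TensorProduct.tmul k y m) (hs x)
  · refine ModuleCat.hom_ext (TensorProduct.ext' fun x m => ?_)
    refine Eq.trans ?_ (congrArg (fun y => TensorProduct.tmul k y m) (hrs x))
    exact (TensorProduct.add_tmul _ _ _).symm

theorem aug_single (g : G) (c : k) : (aug k G).hom (MonoidAlgebra.single g c) = c := by
  simp [aug]

theorem downSeq_shortExact (M : Rep k G) : ((downSeq k G).map (tensorRight M)).ShortExact := by
  let s : (𝟙_ (Rep k G)).V →ₗ[k] (Rep.leftRegular k G).V := MonoidAlgebra.lsingle (R := k) 1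
  let r : (Rep.leftRegular k G).V →ₗ[k] (augKer k G).V :=
    LinearMap.codRestrict _ (LinearMap.id - s ∘ₗ (aug k G).hom.toLinearMap) fun x => by
      refine (map_sub (aug k G).hom.toLinearMap _ _).trans (sub_eq_zero.2 ?_)
      exact (aug_single 1 ((aug k G).hom x)).symm
  refine tensor_shortExact (downSeq k G) r s (fun x => Subtype.ext ?_) (fun x => aug_single (k := k) 1 x)
    (fun x => sub_add_cancel _ _) M
  have hx : (aug k G).hom x.1 = 0 := x.2
  change x.1 - s ((aug k G).hom x.1) = x.1
  rw [hx, map_zero, sub_zero]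

theorem upSeq_shortExact (M : Rep k G) : ((upSeq k G).map (tensorRight M)).ShortExact := by
  let r : (Rep.leftRegular k G).V →ₗ[k] (𝟙_ (Rep k G)).V :=
    Finsupp.lapply 1 ∘ₗ (MonoidAlgebra.coeffLinearEquiv k).toLinearMap
  have hr : ∀ c : (𝟙_ (Rep k G)).V, r ((normElt k G).hom c) = c := fun c => by
    classical
    change ((∑ g : G, MonoidAlgebra.lsingle (R := k) g) (c : k)).coeff 1 = c
    simp [Finsupp.single_apply]
  let s : (normCoker k G).V →ₗ[k] (Rep.leftRegular k G).V :=
    Submodule.liftQ _ (LinearMap.id - (normElt k G).hom.toLinearMap ∘ₗ r) (by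
      rintro _ ⟨c, rfl⟩
      refine sub_eq_zero.2 ?_
      exact congrArg (normElt k G).hom (hr c).symm)
  refine tensor_shortExact (upSeq k G) r s hr (fun x => ?_) (fun x => add_sub_cancel _ _) M
  obtain ⟨x, rfl⟩ := Submodule.Quotient.mk_surjective _ x
  refine (Submodule.Quotient.eq _).2 ⟨-r x, ?_⟩
  refine (map_neg (normElt k G).hom.toLinearMap _).trans ?_
  exact (sub_sub_cancel_left _ _).symm

theorem isZero_tate_leftRegular_tensor (M : Rep k G) (n : ℤ) :
    Limits.IsZero (tateCohomology (Rep.leftRegular k G ⊗ M) n) := by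
  classical
  rw [Limits.IsZero.iff_id_eq_zero, ← (tateCohomologyFunctor n).map_id]
  let p : (Rep.leftRegular k G).V →ₗ[k] (Rep.leftRegular k G).V :=
    MonoidAlgebra.lsingle (R := k) 1 ∘ₗ Finsupp.lapply 1 ∘ₗ
      (MonoidAlgebra.coeffLinearEquiv k).toLinearMap
  have hp : ∀ x : (Rep.leftRegular k G).V, ∑ g : G, (Rep.leftRegular k G).ρ g
      (p ((Rep.leftRegular k G).ρ g⁻¹ x)) = x := fun x => by
    have h : ∑ g : G, (Representation.leftRegular k G g) ∘ₗ p ∘ₗ (Representation.leftRegular k G g⁻¹)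
        = LinearMap.id := by
      ext h : 2
      simp [p, Finsupp.single_apply, inv_mul_eq_one]
      rw [Finset.sum_eq_single h (fun g _ hg => by simp [hg]) (by simp)]
      simp
    have := LinearMap.congr_fun h x
    rw [LinearMap.sum_apply] at this
    exact this
  have h2 : ∑ g : G, ((Rep.leftRegular k G ⊗ M).ρ g) ∘ₗ (p.rTensor M.V) ∘ₗ
      ((Rep.leftRegular k G ⊗ M).ρ g⁻¹) = LinearMap.id := by
    refine TensorProduct.ext' fun x m => ?_
    refine Eq.trans ?_ (congrArg (fun y => TensorProduct.tmul k y m) (hp x))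
    simp only [LinearMap.sum_apply, TensorProduct.sum_tmul]
    refine Finset.sum_congr rfl fun g _ => ?_
    simp
  refine map_eq_zero_of_norm _ (p.rTensor M.V) (fun a => ?_) n
  have := LinearMap.congr_fun h2 a
  simp only [LinearMap.sum_apply] at this
  exact this.symm

/-- The connecting isomorphism `Ĥⁿ(G, M) ≅ Ĥⁿ⁺¹(G, I_G ⊗ M)` of `0 ⟶ I_G ⊗ M ⟶ k[G] ⊗ M ⟶ M ⟶ 0`. -/
def downIso (M : Rep k G) (n m : ℤ) (hnm : n + 1 = m) :
    tateCohomology M n ≅ tateCohomology (augKer k G ⊗ M) m :=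
  (tateCohomologyFunctor n).mapIso (λ_ M).symm ≪≫
    (TateCohomology.map_tateComplexFunctor_shortExact (downSeq_shortExact M)).δIso n m hnm
      (isZero_tate_leftRegular_tensor M n) (isZero_tate_leftRegular_tensor M m)

/-- The connecting isomorphism `Ĥⁿ(G, (k[G]/k N) ⊗ M) ≅ Ĥⁿ⁺¹(G, M)` of
`0 ⟶ M ⟶ k[G] ⊗ M ⟶ (k[G]/k N) ⊗ M ⟶ 0`. -/
def upIso (M : Rep k G) (n m : ℤ) (hnm : n + 1 = m) :
    tateCohomology (normCoker k G ⊗ M) n ≅ tateCohomology M m :=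
  (TateCohomology.map_tateComplexFunctor_shortExact (upSeq_shortExact M)).δIso n m hnm
      (isZero_tate_leftRegular_tensor M n) (isZero_tate_leftRegular_tensor M m) ≪≫
    (tateCohomologyFunctor m).mapIso (λ_ M)

/-! ### Classes of invariants in degree zero -/

/-- An invariant, viewed as a cochain of degree `0`. -/
def invHom (A : Rep k G) : ModuleCat.of k A.ρ.invariants ⟶ (tateComplex A).X 0 :=
  ModuleCat.ofHom (LinearMap.pi fun _ : Fin 0 → G => A.ρ.invariants.subtype)

theorem invHom_comp_d (A : Rep k G) : invHom A ≫ (tateComplex A).d 0 1 = 0 := by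
  have h : (tateComplex A).d 0 1 = inhomogeneousCochains.d A 0 := tateComplex_d_ofNat' 0
  rw [h]
  ext a
  refine funext fun γ => ?_
  have := a.2 (γ 0)
  refine (inhomogeneousCochains.d_hom_apply A 0 _ γ).trans ?_
  simp [invHom]
  change A.ρ (γ 0) a.1 + -a.1 = 0
  rw [this, add_neg_cancel]

/-- The class `[a] ∈ Ĥ⁰(G, A)` of an invariant element `a ∈ A^G`. -/
def tateClass (A : Rep k G) : A.ρ.invariants →ₗ[k] tateCohomology A 0 :=
  ((tateComplex A).liftCycles (invHom A) 1 (by simp) (invHom_comp_d A) ≫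
    (tateComplex A).homologyπ 0).hom

theorem tateClass_surjective (A : Rep k G) : Function.Surjective (tateClass A) := by
  intro z
  obtain ⟨y, rfl⟩ := (ModuleCat.epi_iff_surjective ((tateComplex A).homologyπ 0)).1 inferInstance z
  let c : (Fin 0 → G) → A.V := (tateComplex A).iCycles 0 y
  have hc : (inhomogeneousCochains.d A 0).hom c = 0 := by
    have h : (tateComplex A).d 0 1 = inhomogeneousCochains.d A 0 := tateComplex_d_ofNat' 0
    rw [← h]
    have := (tateComplex A).iCycles_d 0 1
    exact congrArg (fun f => f.hom y) this
  have hinv : ∀ g, A.ρ g (c default) = c default := fun g => by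
    have := congrFun hc fun _ => g
    rw [inhomogeneousCochains.d_hom_apply] at this
    simp at this
    have e : ∀ γ' : Fin 0 → G, c γ' = c default := fun γ' => by rw [Subsingleton.elim γ' default]
    rw [e, e (Fin.contractNth _ _ _)] at this
    exact add_neg_eq_zero.1 this
  refine ⟨⟨c default, hinv⟩, ?_⟩
  refine congrArg ((tateComplex A).homologyπ 0).hom ?_
  apply (ModuleCat.mono_iff_injective ((tateComplex A).iCycles 0)).1 inferInstance
  refine (congrArg (fun f => f.hom (⟨c default, hinv⟩ : A.ρ.invariants))
    ((tateComplex A).liftCycles_i (invHom A) 1 (by simp) (invHom_comp_d A))).trans ?_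
  refine funext fun γ => ?_
  rw [Subsingleton.elim γ default]
  rfl

theorem exists_norm_of_tateClass_eq_zero (A : Rep k G) (a : A.ρ.invariants)
    (ha : tateClass A a = 0) : ∃ b : A.V, a.1 = A.ρ.norm b := by
  have hex := ShortComplex.exact_of_g_is_cokernel (ShortComplex.mk _ _
    ((tateComplex A).toCycles_comp_homologyπ (-1) 0))
    ((tateComplex A).homologyIsCokernel (-1) 0 (by simp))
  obtain ⟨b, hb⟩ := (ShortComplex.moduleCat_exact_iff _).1 hex _ ha
  let b' : (Fin 0 → G) →₀ A.V := b
  refine ⟨b' default, ?_⟩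
  have h1 := congrArg ((tateComplex A).iCycles 0).hom hb
  have h2 : (tateComplex A).d (-1) 0 b = invHom A a := by
    refine Eq.trans ?_ (h1.trans ?_)
    · exact (congrArg (fun f => f.hom b) ((tateComplex A).toCycles_i (-1) 0)).symm
    · exact congrArg (fun f => f.hom a)
        ((tateComplex A).liftCycles_i (invHom A) 1 (by simp) (invHom_comp_d A))
  have h3 : A.tateNorm.hom b' default = a.1 := congrFun h2 default
  rw [← h3, Rep.tateNorm_eq]
  have hb' : b' = Finsupp.single default (b' default) := by
    refine Finsupp.ext fun γ => ?_
    rw [Subsingleton.elim γ default]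
    simp
  rw [hb']
  simp

/-! ### The cup product -/

/-- An invariant `a ∈ A^G` gives the map of `G`-modules `B ⟶ A ⊗ B`, `b ↦ a ⊗ b`. -/
def tensorHom (A B : Rep k G) : A.ρ.invariants →+ (B ⟶ A ⊗ B) where
  toFun a := Rep.ofHom ⟨TensorProduct.mk k A.V B.V a.1, fun g => by
    ext b
    have := a.2 g
    simp [this]⟩
  map_zero' := by ext; simp
  map_add' a a' := by ext; simp [Rep.add_hom]

instance tateAdditive (q : ℤ) : (tateCohomologyFunctor (R := k) (G := G) q).Additive := by
  unfold tateCohomologyFunctor; infer_instance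

/-- For `a ∈ A^G`, the map `Ĥ^q(G, B) ⟶ Ĥ^q(G, A ⊗ B)` induced by `b ↦ a ⊗ b`. -/
def cupInv (A B : Rep k G) (q : ℤ) :
    A.ρ.invariants →+ tateCohomology B q →+ tateCohomology (A ⊗ B) q where
  toFun a := ((tateCohomologyFunctor q).map (tensorHom A B a)).hom.toAddMonoidHom
  map_zero' := by simp; rfl
  map_add' a a' := by simp; rfl

theorem cupInv_eq_zero (A B : Rep k G) (q : ℤ) (a : A.ρ.invariants) (ha : tateClass A a = 0) :
    cupInv A B q a = 0 := by
  obtain ⟨b, hb⟩ := exists_norm_of_tateClass_eq_zero A a ha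
  have h := map_eq_zero_of_norm (tensorHom A B a) (TensorProduct.mk k A.V B.V b) (fun x => by
    change TensorProduct.tmul k a.1 x = _
    rw [hb]
    simp [Representation.norm, TensorProduct.sum_tmul]) q
  ext y
  exact congrArg (fun f => f.hom y) h

/-- The cup product `Ĥ⁰(G, A) × Ĥ^q(G, B) ⟶ Ĥ^q(G, A ⊗ B)`: the unique biadditive map with
`[a] ∪ y = (a ⊗ -)_* y` for `a ∈ A^G`. -/
def cupZero (A B : Rep k G) (q : ℤ) :
    tateCohomology A 0 →+ tateCohomology B q →+ tateCohomology (A ⊗ B) q :=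
  AddMonoidHom.liftOfSurjective (tateClass A).toAddMonoidHom (tateClass_surjective A)
    ⟨cupInv A B q, fun a ha => cupInv_eq_zero A B q a ha⟩

theorem cupZero_tateClass (A B : Rep k G) (q : ℤ) (a : A.ρ.invariants) (y : tateCohomology B q) :
    cupZero A B q (tateClass A a) y = (tateCohomologyFunctor q).map (tensorHom A B a) y :=
  congrArg (fun f => f y) (AddMonoidHom.liftOfRightInverse_comp_apply (tateClass A).toAddMonoidHom
    _ (Function.rightInverse_surjInv (tateClass_surjective A))
    ⟨cupInv A B q, fun a ha => cupInv_eq_zero A B q a ha⟩ a)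

/-- The map on Tate cohomology induced by a map of coefficients, as an additive map. -/
def mapAdd {A B : Rep k G} (n : ℤ) (f : A ⟶ B) : tateCohomology A n →+ tateCohomology B n :=
  ((tateCohomologyFunctor n).map f).hom.toAddMonoidHom

/-- The cup product with first variable in degree `p ≥ 0`, by `δ a ∪ y = δ (a ∪ y)` for the
sequences `0 ⟶ A ⟶ k[G] ⊗ A ⟶ (k[G]/k N) ⊗ A ⟶ 0` and
`0 ⟶ A ⊗ B ⟶ k[G] ⊗ (A ⊗ B) ⟶ (k[G]/k N) ⊗ (A ⊗ B) ⟶ 0`. -/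
def cupNat : ∀ (p : ℕ) (A B : Rep k G) (q n : ℤ), (p : ℤ) + q = n →
    (tateCohomology A p →+ tateCohomology B q →+ tateCohomology (A ⊗ B) n)
  | 0, A, B, q, n, h => (show q = n by simpa using h) ▸ cupZero A B q
  | p + 1, A, B, q, n, h =>
    (AddMonoidHom.compHom ((upIso (A ⊗ B) (n - 1) n (by omega)).hom.hom.toAddMonoidHom.comp
      (mapAdd (n - 1) (α_ (normCoker k G) A B).hom))).comp
    ((cupNat p (normCoker k G ⊗ A) B q (n - 1) (by push_cast at h; omega)).comp
      (upIso A p (p + 1 : ℕ) (by simp)).inv.hom.toAddMonoidHom)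

/-- The cup product with first variable in degree `-p ≤ 0`, by `δ (a ∪ y) = δ a ∪ y` for the
sequences `0 ⟶ I_G ⊗ A ⟶ k[G] ⊗ A ⟶ A ⟶ 0` and
`0 ⟶ I_G ⊗ (A ⊗ B) ⟶ k[G] ⊗ (A ⊗ B) ⟶ A ⊗ B ⟶ 0`. -/
def cupNeg : ∀ (p : ℕ) (A B : Rep k G) (q n : ℤ), -(p : ℤ) + q = n →
    (tateCohomology A (-(p : ℤ)) →+ tateCohomology B q →+ tateCohomology (A ⊗ B) n)
  | 0, A, B, q, n, h => (show q = n by simpa using h) ▸ cupZero A B q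
  | p + 1, A, B, q, n, h =>
    (AddMonoidHom.compHom ((downIso (A ⊗ B) n (n + 1) rfl).inv.hom.toAddMonoidHom.comp
      (mapAdd (n + 1) (α_ (augKer k G) A B).hom))).comp
    ((cupNeg p (augKer k G ⊗ A) B q (n + 1) (by push_cast at h; omega)).comp
      (downIso A (-((p + 1 : ℕ) : ℤ)) (-(p : ℤ)) (by push_cast; ring)).hom.hom.toAddMonoidHom)

/-- The cup product `Ĥ^p(G, A) × Ĥ^q(G, B) ⟶ Ĥⁿ(G, A ⊗ B)` for `p + q = n` in `ℤ`. -/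
def cup : ∀ {A B : Rep k G} {p q n : ℤ}, p + q = n →
    (tateCohomology A p →+ tateCohomology B q →+ tateCohomology (A ⊗ B) n)
  | A, B, .ofNat p, q, n, h => cupNat p A B q n h
  | A, B, .negSucc p, q, n, h => cupNeg (p + 1) A B q n h

/-! ### Encoding pairs -/

/-- The functor `Homₖ(X, -)` from `G`-modules to `G`-modules, with `(g f)(x) = g f(g⁻¹ x)`. -/
abbrev homFunctor (X : Rep.{u} k G) : Rep.{u} k G ⥤ Rep.{u} k G := Rep.ihom X

/-- The `G`-module `Homₖ(X, Y)`. -/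
abbrev homRep (X Y : Rep.{u} k G) : Rep.{u} k G := (homFunctor X).obj Y

/-- Composition `Homₖ(Y, Z) ⊗ Homₖ(X, Y) ⟶ Homₖ(X, Z)`, `f ⊗ φ ↦ f ∘ φ`. -/
def compHom (X Y Z : Rep.{u} k G) : homRep Y Z ⊗ homRep X Y ⟶ homRep X Z :=
  Rep.ofHom ⟨TensorProduct.lift (LinearMap.llcomp k X.V Y.V Z.V), fun g => by
    refine TensorProduct.ext' fun (f : Y.V →ₗ[k] Z.V) (φ : X.V →ₗ[k] Y.V) =>
      LinearMap.ext fun x => ?_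
    change Z.ρ g (f (Y.ρ g⁻¹ (Y.ρ g (φ (X.ρ g⁻¹ x))))) = Z.ρ g (f (φ (X.ρ g⁻¹ x)))
    simp⟩

/-- The cup product `Ĥ^p(G, Homₖ(Y, Z)) × Ĥ^q(G, Homₖ(X, Y)) ⟶ Ĥⁿ(G, Homₖ(X, Z))` induced by
composition. -/
def cupComp {X Y Z : Rep.{u} k G} {p q n : ℤ} (h : p + q = n)
    (a : tateCohomology (homRep Y Z) p) (x : tateCohomology (homRep X Y) q) :
    tateCohomology (homRep X Z) n :=
  (tateCohomologyFunctor n).map (compHom X Y Z) (cup h a x)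

/-- The class `[id_X] ∈ Ĥ⁰(G, Homₖ(X, X))`. -/
def idClass (X : Rep.{u} k G) : tateCohomology (homRep X X) 0 :=
  tateClass (homRep X X) ⟨(LinearMap.id : X.V →ₗ[k] X.V), fun g => by
    refine LinearMap.ext fun x => ?_
    change X.ρ g (X.ρ g⁻¹ x) = x
    simp⟩

/-- The functor `Ĥⁱ(G, Homₖ(X, -))` from `G`-modules to `k`-modules. -/
abbrev homCohomology (X : Rep.{u} k G) (i : ℤ) : Rep.{u} k G ⥤ ModuleCat.{u} k :=
  homFunctor X ⋙ tateCohomologyFunctor i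

/-- `(X, X')` is an `r`-encoding pair: there is a natural isomorphism
`Ĥⁱ(G, Hom(X, -)) ≅ Ĥⁱ⁺ʳ(G, Hom(X', -))` for some `i ∈ ℤ`. -/
def IsEncodingPair (r : ℤ) (X X' : Rep.{u} k G) : Prop :=
  ∃ i : ℤ, Nonempty (homCohomology X i ≅ homCohomology X' (i + r))

end TateCup

end

/-!
The equivalence is the Yoneda lemma in the graded category whose morphisms `X' ⟶ X` of degree `r`
are the classes in `Ĥʳ(G, Homₖ(X', X))`, composed by the product `a ∪ x`. Three facts about this
product are needed: it is natural in the target of `a`, it is associative with the classes `[id]` as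
two-sided units, and `a ↦ a ∪ x` commutes with dimension shifting in `a`. The last of these implies
the rest of the second, because in degree zero every class is `[f]` for a map of `G`-modules `f`,
and `[f] ∪ b = f_* b`; associativity and the unit laws are trivial there, and dimension shifting in
the first variable carries them to all degrees (`homCohomology_induction`, `cupComp_assoc`,
`cupComp_idClass`).

Compatibility with dimension shifting is the rule `δ a ∪ b = δ (a ∪ b)` for every `k`-split short
exact sequence `X₁ ⟶ X₂ ⟶ X₃` (`cup_connecting`). The cup product is defined by this rule for the
sequence starting with `M ⟶ k[G] ⊗ M` when `a` has degree `≥ 0`, and for the sequence ending with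
`k[G] ⊗ M ⟶ M` when `a` has degree `< 0`. A `k`-split sequence maps to the former sequence for
`M = X₁`, over the identity of `X₁`, and receives a map from the latter for `M = X₃`, over the
identity of `X₃`. So its connecting homomorphism factors through either shift, and whichever of the
two governs the degree of `a` gives the rule. No two connecting homomorphisms are ever interchanged,
hence no signs appear.

Applied to `Homₖ(X, -)` of the two shifting sequences, whose middle term stays cohomologically
trivial, the rule shows that bijectivity of `a ↦ a ∪ x` in degree zero propagates to all degrees
(`cupComp_bijective`). An arbitrary natural isomorphism in a single degree is shifted to degree zero
(`nonempty_iso_zero`), where it equals `a ↦ a ∪ x` for `x` the image of `[id_X]`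
(`exists_cupComp_bijective`). The inverse class `x'` is the preimage of `[id_X']`
(`exists_inverse`), and conversely `b ↦ b ∪ x'` inverts `a ↦ a ∪ x`.
-/

noncomputable section

namespace TateCup

open MonoidalCategory

universe u

variable {k G : Type u} [CommRing k] [Group G]

/-! ### `k`-split sequences of `G`-modules -/

/-- A splitting of the sequence of `k`-modules underlying a short complex of `G`-modules, by a
`k`-linear retraction `r` and a `k`-linear section `s`, neither of them assumed equivariant. -/
structure LinearSplitting (S : ShortComplex (Rep k G)) where
  r : S.X₂.V →ₗ[k] S.X₁.V
  s : S.X₃.V →ₗ[k] S.X₂.V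
  r_f : ∀ x, r (S.f.hom x) = x
  g_s : ∀ x, S.g.hom (s x) = x
  f_r_add_s_g : ∀ x, S.f.hom (r x) + s (S.g.hom x) = x

namespace LinearSplitting

theorem shortExact {S : ShortComplex (Rep k G)} (σ : LinearSplitting S) : S.ShortExact :=
  ShortExact.reflects_shortExact_of_faithful (forget₂ (Rep k G) (ModuleCat k))
    (ShortComplex.Splitting.shortExact
      { r := ModuleCat.ofHom σ.r
        s := ModuleCat.ofHom σ.s
        f_r := ModuleCat.hom_ext (LinearMap.ext σ.r_f)
        s_g := ModuleCat.hom_ext (LinearMap.ext σ.g_s)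
        id := ModuleCat.hom_ext (LinearMap.ext σ.f_r_add_s_g) })

/-- Tensoring a `k`-split sequence with `M`. -/
def tensorRight {S : ShortComplex (Rep k G)} (σ : LinearSplitting S) (M : Rep k G) :
    LinearSplitting (S.map (tensorRight M)) where
  r := σ.r.rTensor M.V
  s := σ.s.rTensor M.V
  r_f := LinearMap.congr_fun (f := σ.r.rTensor M.V ∘ₗ S.f.hom.toLinearMap.rTensor M.V)
    (g := LinearMap.id) (TensorProduct.ext' fun x m =>
      congrArg (fun y => TensorProduct.tmul k y m) (σ.r_f x))
  g_s := LinearMap.congr_fun (f := S.g.hom.toLinearMap.rTensor M.V ∘ₗ σ.s.rTensor M.V)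
    (g := LinearMap.id) (TensorProduct.ext' fun x m =>
      congrArg (fun y => TensorProduct.tmul k y m) (σ.g_s x))
  f_r_add_s_g := LinearMap.congr_fun
    (f := S.f.hom.toLinearMap.rTensor M.V ∘ₗ σ.r.rTensor M.V +
      σ.s.rTensor M.V ∘ₗ S.g.hom.toLinearMap.rTensor M.V)
    (g := LinearMap.id) (TensorProduct.ext' fun x m => by
      refine Eq.trans ?_ (congrArg (fun y => TensorProduct.tmul k y m) (σ.f_r_add_s_g x))
      exact (TensorProduct.add_tmul _ _ _).symm)

instance (X : Rep.{u} k G) : (homFunctor X).PreservesZeroMorphisms where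
  map_zero _ _ := rfl

/-- Applying `Homₖ(X, -)` to a `k`-split sequence. -/
def hom {S : ShortComplex (Rep.{u} k G)} (σ : LinearSplitting S) (X : Rep.{u} k G) :
    LinearSplitting (S.map (homFunctor X)) where
  r := LinearMap.llcomp k X.V _ _ σ.r
  s := LinearMap.llcomp k X.V _ _ σ.s
  r_f f := LinearMap.ext fun x => σ.r_f ((show X.V →ₗ[k] S.X₁.V from f) x)
  g_s f := LinearMap.ext fun x => σ.g_s ((show X.V →ₗ[k] S.X₃.V from f) x)
  f_r_add_s_g f := LinearMap.ext fun x => σ.f_r_add_s_g ((show X.V →ₗ[k] S.X₂.V from f) x)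

end LinearSplitting

variable [Fintype G]

/-- The sequence `0 ⟶ I_G ⟶ k[G] ⟶ k ⟶ 0` is split by `1 ↦ 1`. -/
def downSeqSplitting (k G : Type u) [CommRing k] [Group G] [Fintype G] :
    LinearSplitting (downSeq k G) :=
  let s : (𝟙_ (Rep k G)).V →ₗ[k] (Rep.leftRegular k G).V := MonoidAlgebra.lsingle (R := k) 1
  let r : (Rep.leftRegular k G).V →ₗ[k] (augKer k G).V :=
    LinearMap.codRestrict _ (LinearMap.id - s ∘ₗ (aug k G).hom.toLinearMap) fun x => by
      refine (map_sub (aug k G).hom.toLinearMap _ _).trans (sub_eq_zero.2 ?_)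
      exact (aug_single 1 ((aug k G).hom x)).symm
  LinearSplitting.mk r s
    (fun x => Subtype.ext <| by
      have hx : (aug k G).hom x.1 = 0 := x.2
      change x.1 - s ((aug k G).hom x.1) = x.1
      rw [hx, map_zero, sub_zero])
    (fun x => aug_single (k := k) 1 x) (fun x => by
      have h : ∀ y z : (Rep.leftRegular k G).V, y - z + z = y := sub_add_cancel
      exact h x (s ((aug k G).hom x)))

/-- The coefficient of `1`, as a retraction of `k ⟶ k[G]`, `1 ↦ N`. -/
def coeffOne (k G : Type u) [CommRing k] [Group G] :
    (Rep.leftRegular k G).V →ₗ[k] (𝟙_ (Rep k G)).V :=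
  Finsupp.lapply 1 ∘ₗ (MonoidAlgebra.coeffLinearEquiv k).toLinearMap

theorem coeffOne_normElt (c : (𝟙_ (Rep k G)).V) : coeffOne k G ((normElt k G).hom c) = c := by
  classical
  change ((∑ g : G, MonoidAlgebra.lsingle (R := k) g) (c : k)).coeff 1 = c
  simp [Finsupp.single_apply]

/-- The sequence `0 ⟶ k ⟶ k[G] ⟶ k[G]/k N ⟶ 0` is split by the coefficient of `1`. -/
def upSeqSplitting (k G : Type u) [CommRing k] [Group G] [Fintype G] :
    LinearSplitting (upSeq k G) :=
  let s : (normCoker k G).V →ₗ[k] (Rep.leftRegular k G).V :=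
    Submodule.liftQ _ (LinearMap.id - (normElt k G).hom.toLinearMap ∘ₗ coeffOne k G) (by
      rintro _ ⟨c, rfl⟩
      refine sub_eq_zero.2 ?_
      exact congrArg (normElt k G).hom (coeffOne_normElt c).symm)
  LinearSplitting.mk (coeffOne k G) s coeffOne_normElt
    (fun x => by
      obtain ⟨x, rfl⟩ := Submodule.Quotient.mk_surjective _ x
      refine (Submodule.Quotient.eq _).2 ⟨-coeffOne k G x, ?_⟩
      refine (map_neg (normElt k G).hom.toLinearMap _).trans ?_
      exact (sub_sub_cancel_left _ _).symm)
    (fun x => by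
      have h : ∀ y z : (Rep.leftRegular k G).V, y + (z - y) = z := add_sub_cancel
      exact h ((normElt k G).hom (coeffOne k G x)) x)

/-! ### Comparison with the two dimension shifting sequences -/

section Comparison

variable {S : ShortComplex (Rep k G)} (σ : LinearSplitting S)

/-- The map `X₂ ⟶ k[G] ⊗ X₁`, `b ↦ ∑ g, g ⊗ g r(g⁻¹ b)`, extending `X₁ ⟶ k[G] ⊗ X₁` to `X₂`. -/
def toInduced : S.X₂ ⟶ Rep.leftRegular k G ⊗ S.X₁ :=
  Rep.ofHom ⟨∑ g : G,
      TensorProduct.mk k (Rep.leftRegular k G).V S.X₁.V (MonoidAlgebra.single g 1) ∘ₗ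
        S.X₁.ρ g ∘ₗ σ.r ∘ₗ S.X₂.ρ g⁻¹, fun h => by
    ext b
    simp only [LinearMap.comp_apply, LinearMap.sum_apply, map_sum, TensorProduct.mk_apply]
    refine (Fintype.sum_equiv (Equiv.mulLeft h) _ _ fun g => ?_).symm
    simp⟩

theorem f_toInduced :
    S.f ≫ toInduced σ = (λ_ S.X₁).inv ≫ normElt k G ▷ S.X₁ := by
  refine Rep.hom_ext (Representation.IntertwiningMap.ext (LinearMap.ext fun a => ?_))
  change (∑ g : G, TensorProduct.mk k (Rep.leftRegular k G).V S.X₁.V (MonoidAlgebra.single g 1) ∘ₗ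
      S.X₁.ρ g ∘ₗ σ.r ∘ₗ S.X₂.ρ g⁻¹) (S.f.hom a) =
    TensorProduct.tmul k ((∑ g : G, MonoidAlgebra.lsingle (R := k) g) (1 : k)) a
  simp [← Rep.hom_comm_apply, σ.r_f, TensorProduct.sum_tmul]

/-- The map `k[G] ⊗ X₃ ⟶ X₂`, `g ⊗ c ↦ g s(g⁻¹ c)`, lifting `k[G] ⊗ X₃ ⟶ X₃` to `X₂`. -/
def ofInduced : Rep.leftRegular k G ⊗ S.X₃ ⟶ S.X₂ :=
  Rep.ofHom ⟨TensorProduct.lift (Finsupp.lsum k (fun g : G => LinearMap.toSpanSingleton k _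
      (S.X₂.ρ g ∘ₗ σ.s ∘ₗ S.X₃.ρ g⁻¹)) ∘ₗ (MonoidAlgebra.coeffLinearEquiv k).toLinearMap),
    fun h => by
    ext g c
    simp⟩

theorem ofInduced_g :
    ofInduced σ ≫ S.g = aug k G ▷ S.X₃ ≫ (λ_ S.X₃).hom := by
  refine Rep.hom_ext (Representation.IntertwiningMap.ext ?_)
  refine TensorProduct.ext (MonoidAlgebra.lhom_ext' fun g => LinearMap.ext_ring
    (LinearMap.ext fun c => ?_))
  have h : (ofInduced σ).hom (TensorProduct.tmul k (MonoidAlgebra.single g 1) c) =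
      S.X₂.ρ g (σ.s (S.X₃.ρ g⁻¹ c)) := by
    simp [ofInduced]
  change S.g.hom ((ofInduced σ).hom (TensorProduct.tmul k (MonoidAlgebra.single g 1) c)) =
    TensorProduct.lid k S.X₃.V
      (TensorProduct.tmul k ((aug k G).hom (MonoidAlgebra.single g (1 : k))) c)
  rw [h, Rep.hom_comm_apply, σ.g_s, aug_single]
  simp

end Comparison

/-! ### Connecting homomorphisms -/

/-- The connecting homomorphism `Ĥⁱ(G, X₃) ⟶ Ĥʲ(G, X₁)` for `j = i + 1`. -/
abbrev connecting {S : ShortComplex (Rep k G)} (hS : S.ShortExact) (i j : ℤ) (hij : i + 1 = j) :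
    tateCohomology S.X₃ i ⟶ tateCohomology S.X₁ j :=
  (TateCohomology.map_tateComplexFunctor_shortExact hS).δ i j hij

theorem connecting_naturality {S T : ShortComplex (Rep k G)} (hS : S.ShortExact)
    (hT : T.ShortExact) (F : S ⟶ T) (i j : ℤ) (hij : i + 1 = j) :
    connecting hS i j hij ≫ (tateCohomologyFunctor j).map F.τ₁ =
      (tateCohomologyFunctor i).map F.τ₃ ≫ connecting hT i j hij :=
  HomologicalComplex.HomologySequence.δ_naturality
    ((tateComplexFunctor k G).mapShortComplex.map F)
    (TateCohomology.map_tateComplexFunctor_shortExact hS)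
    (TateCohomology.map_tateComplexFunctor_shortExact hT) i j hij

theorem connecting_naturality_apply {S T : ShortComplex (Rep k G)} (hS : S.ShortExact)
    (hT : T.ShortExact) (F : S ⟶ T) (i j : ℤ) (hij : i + 1 = j) (a : tateCohomology S.X₃ i) :
    (tateCohomologyFunctor j).map F.τ₁ (connecting hS i j hij a) =
      connecting hT i j hij ((tateCohomologyFunctor i).map F.τ₃ a) :=
  congrArg (fun f => f.hom a) (connecting_naturality hS hT F i j hij)

theorem tate_map_comp_apply {A B C : Rep k G} (n : ℤ) (f : A ⟶ B) (g : B ⟶ C)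
    (a : tateCohomology A n) : (tateCohomologyFunctor n).map (f ≫ g) a =
      (tateCohomologyFunctor n).map g ((tateCohomologyFunctor n).map f a) := by
  rw [Functor.map_comp]
  rfl

/-! ### The dimension shifts compute all connecting homomorphisms -/

/-- The projection `k[G] ⟶ k[G]/k N`. -/
def normCokerProj (k G : Type u) [CommRing k] [Group G] [Fintype G] :
    Rep.leftRegular k G ⟶ normCoker k G := (upSeq k G).g

/-- The inclusion `I_G ⟶ k[G]`. -/
def augKerIncl (k G : Type u) [CommRing k] [Group G] : augKer k G ⟶ Rep.leftRegular k G :=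
  (downSeq k G).f

/-- The connecting homomorphism of `0 ⟶ M ⟶ k[G] ⊗ M ⟶ (k[G]/k N) ⊗ M ⟶ 0`. -/
def upConnecting (M : Rep k G) (i j : ℤ) (hij : i + 1 = j) :
    tateCohomology (normCoker k G ⊗ M) i ⟶ tateCohomology (𝟙_ (Rep k G) ⊗ M) j :=
  connecting (upSeq_shortExact M) i j hij

/-- The connecting homomorphism of `0 ⟶ I_G ⊗ M ⟶ k[G] ⊗ M ⟶ M ⟶ 0`. -/
def downConnecting (M : Rep k G) (i j : ℤ) (hij : i + 1 = j) :
    tateCohomology (𝟙_ (Rep k G) ⊗ M) i ⟶ tateCohomology (augKer k G ⊗ M) j :=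
  connecting (downSeq_shortExact M) i j hij

theorem upIso_hom (M : Rep k G) (i j : ℤ) (hij : i + 1 = j) :
    (upIso M i j hij).hom = upConnecting M i j hij ≫ (tateCohomologyFunctor j).map (λ_ M).hom :=
  rfl

theorem downIso_hom (M : Rep k G) (i j : ℤ) (hij : i + 1 = j) :
    (downIso M i j hij).hom =
      (tateCohomologyFunctor i).map (λ_ M).inv ≫ downConnecting M i j hij :=
  rfl

theorem upConnecting_naturality {A B : Rep k G} (f : A ⟶ B) (i j : ℤ) (hij : i + 1 = j) :
    upConnecting A i j hij ≫ (tateCohomologyFunctor j).map (𝟙_ (Rep k G) ◁ f) =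
      (tateCohomologyFunctor i).map (normCoker k G ◁ f) ≫ upConnecting B i j hij :=
  connecting_naturality (upSeq_shortExact A) (upSeq_shortExact B)
    ((upSeq k G).mapNatTrans ((tensoringRight (Rep k G)).map f)) i j hij

theorem downConnecting_naturality {A B : Rep k G} (f : A ⟶ B) (i j : ℤ) (hij : i + 1 = j) :
    downConnecting A i j hij ≫ (tateCohomologyFunctor j).map (augKer k G ◁ f) =
      (tateCohomologyFunctor i).map (𝟙_ (Rep k G) ◁ f) ≫ downConnecting B i j hij :=
  connecting_naturality (downSeq_shortExact A) (downSeq_shortExact B)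
    ((downSeq k G).mapNatTrans ((tensoringRight (Rep k G)).map f)) i j hij

theorem upIso_naturality {A B : Rep k G} (f : A ⟶ B) (i j : ℤ) (hij : i + 1 = j) :
    (upIso A i j hij).hom ≫ (tateCohomologyFunctor j).map f =
      (tateCohomologyFunctor i).map (normCoker k G ◁ f) ≫ (upIso B i j hij).hom := by
  rw [upIso_hom, upIso_hom, Category.assoc, ← Functor.map_comp, ← leftUnitor_naturality,
    Functor.map_comp, ← Category.assoc, upConnecting_naturality, Category.assoc]

theorem downIso_naturality {A B : Rep k G} (f : A ⟶ B) (i j : ℤ) (hij : i + 1 = j) :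
    (downIso A i j hij).hom ≫ (tateCohomologyFunctor j).map (augKer k G ◁ f) =
      (tateCohomologyFunctor i).map f ≫ (downIso B i j hij).hom := by
  rw [downIso_hom, downIso_hom, ← Category.assoc, ← Functor.map_comp, leftUnitor_inv_naturality,
    Functor.map_comp, Category.assoc, downConnecting_naturality, Category.assoc]

theorem upIso_naturality_apply {A B : Rep k G} (f : A ⟶ B) (i j : ℤ) (hij : i + 1 = j)
    (a : tateCohomology (normCoker k G ⊗ A) i) :
    (tateCohomologyFunctor j).map f ((upIso A i j hij).hom a) =
      (upIso B i j hij).hom ((tateCohomologyFunctor i).map (normCoker k G ◁ f) a) :=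
  congrArg (fun φ => φ.hom a) (upIso_naturality f i j hij)

theorem downIso_naturality_apply {A B : Rep k G} (f : A ⟶ B) (i j : ℤ) (hij : i + 1 = j)
    (a : tateCohomology A i) :
    (downIso B i j hij).hom ((tateCohomologyFunctor i).map f a) =
      (tateCohomologyFunctor j).map (augKer k G ◁ f) ((downIso A i j hij).hom a) :=
  congrArg (fun φ => φ.hom a) (downIso_naturality f i j hij).symm

/-- The connecting homomorphism of a sequence mapping to `0 ⟶ X₁ ⟶ k[G] ⊗ X₁ ⟶ (k[G]/k N) ⊗ X₁ ⟶ 0`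
over the identity of `X₁` factors through `upIso`. -/
theorem connecting_eq_upIso {S : ShortComplex (Rep k G)} (hS : S.ShortExact)
    (t₂ : S.X₂ ⟶ Rep.leftRegular k G ⊗ S.X₁) (t₃ : S.X₃ ⟶ normCoker k G ⊗ S.X₁)
    (h₁₂ : (λ_ S.X₁).inv ≫ normElt k G ▷ S.X₁ = S.f ≫ t₂)
    (h₂₃ : t₂ ≫ normCokerProj k G ▷ S.X₁ = S.g ≫ t₃) (i j : ℤ) (hij : i + 1 = j) :
    connecting hS i j hij = (tateCohomologyFunctor i).map t₃ ≫ (upIso S.X₁ i j hij).hom := by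
  have h : connecting hS i j hij ≫ (tateCohomologyFunctor j).map (λ_ S.X₁).inv =
      (tateCohomologyFunctor i).map t₃ ≫ upConnecting S.X₁ i j hij :=
    connecting_naturality hS (upSeq_shortExact S.X₁)
      { τ₁ := (λ_ S.X₁).inv, τ₂ := t₂, τ₃ := t₃, comm₁₂ := h₁₂, comm₂₃ := h₂₃ } i j hij
  rw [upIso_hom, ← Category.assoc, ← h, Category.assoc, ← Functor.map_comp, Iso.inv_hom_id,
    CategoryTheory.Functor.map_id, Category.comp_id]

/-- The connecting homomorphism of a sequence receiving a map from
`0 ⟶ I_G ⊗ X₃ ⟶ k[G] ⊗ X₃ ⟶ X₃ ⟶ 0` over the identity of `X₃` factors through `downIso`. -/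
theorem connecting_eq_downIso {S : ShortComplex (Rep k G)} (hS : S.ShortExact)
    (t₁ : augKer k G ⊗ S.X₃ ⟶ S.X₁) (t₂ : Rep.leftRegular k G ⊗ S.X₃ ⟶ S.X₂)
    (h₁₂ : t₁ ≫ S.f = augKerIncl k G ▷ S.X₃ ≫ t₂)
    (h₂₃ : t₂ ≫ S.g = aug k G ▷ S.X₃ ≫ (λ_ S.X₃).hom) (i j : ℤ) (hij : i + 1 = j) :
    connecting hS i j hij = (downIso S.X₃ i j hij).hom ≫ (tateCohomologyFunctor j).map t₁ := by
  have h : downConnecting S.X₃ i j hij ≫ (tateCohomologyFunctor j).map t₁ =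
      (tateCohomologyFunctor i).map (λ_ S.X₃).hom ≫ connecting hS i j hij :=
    connecting_naturality (downSeq_shortExact S.X₃) hS
      { τ₁ := t₁, τ₂ := t₂, τ₃ := (λ_ S.X₃).hom, comm₁₂ := h₁₂, comm₂₃ := h₂₃ } i j hij
  rw [downIso_hom, Category.assoc, h, ← Category.assoc, ← Functor.map_comp, Iso.inv_hom_id,
    CategoryTheory.Functor.map_id, Category.id_comp]

theorem normElt_comp_normCokerProj : normElt k G ≫ normCokerProj k G = 0 := (upSeq k G).zero

omit [Fintype G] in
theorem augKerIncl_comp_aug : augKerIncl k G ≫ aug k G = 0 := (downSeq k G).zero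

/-- Since `toInduced` extends `X₁ ⟶ k[G] ⊗ X₁`, it descends to `X₃ ⟶ (k[G]/k N) ⊗ X₁`. -/
theorem exists_toNormCoker {S : ShortComplex (Rep k G)} (σ : LinearSplitting S) :
    ∃ t₃ : S.X₃ ⟶ normCoker k G ⊗ S.X₁,
      toInduced σ ≫ normCokerProj k G ▷ S.X₁ = S.g ≫ t₃ := by
  have := σ.shortExact.epi_g
  refine ⟨σ.shortExact.exact.desc _ ?_, (ShortComplex.Exact.g_desc ..).symm⟩
  rw [← Category.assoc, f_toInduced, Category.assoc, ← comp_whiskerRight,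
    normElt_comp_normCokerProj, MonoidalPreadditive.zero_whiskerRight, Limits.comp_zero]

/-- Since `ofInduced` lifts `k[G] ⊗ X₃ ⟶ X₃`, it restricts to `I_G ⊗ X₃ ⟶ X₁`. -/
theorem exists_ofAugKer {S : ShortComplex (Rep k G)} (σ : LinearSplitting S) :
    ∃ t₁ : augKer k G ⊗ S.X₃ ⟶ S.X₁, t₁ ≫ S.f = augKerIncl k G ▷ S.X₃ ≫ ofInduced σ := by
  have := σ.shortExact.mono_f
  refine ⟨σ.shortExact.exact.lift _ ?_, ShortComplex.Exact.lift_f ..⟩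
  rw [Category.assoc, ofInduced_g, ← Category.assoc, ← comp_whiskerRight,
    augKerIncl_comp_aug, MonoidalPreadditive.zero_whiskerRight, Limits.zero_comp]

/-! ### Naturality of the cup product in the first variable -/

theorem map_tateClass {A B : Rep k G} (f : A ⟶ B) (a : A.ρ.invariants) (b : B.ρ.invariants)
    (hab : f.hom a.1 = b.1) :
    (tateCohomologyFunctor 0).map f (tateClass A a) = tateClass B b := by
  let φ := tateComplex.map f
  let z := (tateComplex A).liftCycles (invHom A) 1 (by simp) (invHom_comp_d A) a
  have h₁ : (tateCohomologyFunctor 0).map f (tateClass A a) =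
      (tateComplex B).homologyπ 0 (HomologicalComplex.cyclesMap φ 0 z) :=
    congrArg (fun ψ => ψ.hom z) (HomologicalComplex.homologyπ_naturality φ 0)
  rw [h₁]
  refine congrArg ((tateComplex B).homologyπ 0).hom ?_
  apply (ModuleCat.mono_iff_injective ((tateComplex B).iCycles 0)).1 inferInstance
  have h₂ := congrArg (fun ψ => ψ.hom a)
    ((tateComplex A).liftCycles_i (invHom A) 1 (by simp) (invHom_comp_d A))
  have h₃ := congrArg (fun ψ => ψ.hom b)
    ((tateComplex B).liftCycles_i (invHom B) 1 (by simp) (invHom_comp_d B))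
  refine Eq.trans ?_ h₃.symm
  refine (congrArg (fun ψ => ψ.hom z) (HomologicalComplex.cyclesMap_i φ 0)).trans ?_
  refine (congrArg (φ.f 0).hom h₂).trans ?_
  exact funext fun _ => hab

theorem cupZero_map {A A' : Rep k G} (B : Rep k G) (f : A ⟶ A') (q : ℤ) (a : tateCohomology A 0)
    (b : tateCohomology B q) : cupZero A' B q ((tateCohomologyFunctor 0).map f a) b =
      (tateCohomologyFunctor q).map (f ▷ B) (cupZero A B q a b) := by
  obtain ⟨a, rfl⟩ := tateClass_surjective A a
  let a' : A'.ρ.invariants := ⟨f.hom a.1, fun g => by rw [← Rep.hom_comm_apply, a.2 g]⟩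
  rw [map_tateClass f a a' rfl, cupZero_tateClass, cupZero_tateClass, ← tate_map_comp_apply]
  rfl

theorem cupNat_succ_upIso (p : ℕ) (A B : Rep k G) (q n m : ℤ) (hn : (p : ℤ) + q = n)
    (hm : ((p + 1 : ℕ) : ℤ) + q = m) (hnm : n + 1 = m)
    (a : tateCohomology (normCoker k G ⊗ A) p) (b : tateCohomology B q) :
    cupNat (p + 1) A B q m hm ((upIso A p (p + 1 : ℕ) (by simp)).hom a) b =
      (upIso (A ⊗ B) n m hnm).hom ((tateCohomologyFunctor n).map (α_ (normCoker k G) A B).hom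
        (cupNat p (normCoker k G ⊗ A) B q n hn a b)) := by
  obtain rfl : n = m - 1 := by omega
  have h := Iso.hom_inv_id_apply (upIso A p (p + 1 : ℕ) (by simp)) a
  exact congrArg (fun a => (upIso (A ⊗ B) (m - 1) m hnm).hom
    ((tateCohomologyFunctor (m - 1)).map (α_ (normCoker k G) A B).hom
        (cupNat p (normCoker k G ⊗ A) B q (m - 1) hn a b))) h

theorem downIso_cupNeg_succ (p : ℕ) (A B : Rep k G) (q n m : ℤ)
    (hn : -((p + 1 : ℕ) : ℤ) + q = n) (hm : -(p : ℤ) + q = m) (hnm : n + 1 = m)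
    (a : tateCohomology A (-((p + 1 : ℕ) : ℤ))) (b : tateCohomology B q) :
    (downIso (A ⊗ B) n m hnm).hom (cupNeg (p + 1) A B q n hn a b) =
      (tateCohomologyFunctor m).map (α_ (augKer k G) A B).hom
        (cupNeg p (augKer k G ⊗ A) B q m hm
          ((downIso A (-((p + 1 : ℕ) : ℤ)) (-(p : ℤ)) (by push_cast; ring)).hom a) b) := by
  subst hnm
  exact Iso.inv_hom_id_apply (downIso (A ⊗ B) n (n + 1) rfl) _

theorem cupNat_map (p : ℕ) {A A' : Rep k G} (B : Rep k G) (f : A ⟶ A') (q n : ℤ)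
    (h : (p : ℤ) + q = n) (a : tateCohomology A p) (b : tateCohomology B q) :
    cupNat p A' B q n h ((tateCohomologyFunctor p).map f a) b =
      (tateCohomologyFunctor n).map (f ▷ B) (cupNat p A B q n h a b) := by
  induction p generalizing A A' n with
  | zero =>
    obtain rfl : q = n := by simpa using h
    exact cupZero_map B f q a b
  | succ p ih =>
    obtain ⟨a, rfl⟩ : ∃ a', (upIso A p (p + 1 : ℕ) (by simp)).hom a' = a :=
      ⟨_, Iso.inv_hom_id_apply (upIso A p (p + 1 : ℕ) (by simp)) a⟩
    have hn : (p : ℤ) + q = n - 1 := by push_cast at h; omega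
    rw [upIso_naturality_apply, cupNat_succ_upIso p A' B q (n - 1) n hn h (by omega),
      cupNat_succ_upIso p A B q (n - 1) n hn h (by omega), upIso_naturality_apply, ih,
      ← tate_map_comp_apply, ← tate_map_comp_apply, associator_naturality_middle]

theorem cupNeg_map (p : ℕ) {A A' : Rep k G} (B : Rep k G) (f : A ⟶ A') (q n : ℤ)
    (h : -(p : ℤ) + q = n) (a : tateCohomology A (-(p : ℤ))) (b : tateCohomology B q) :
    cupNeg p A' B q n h ((tateCohomologyFunctor (-(p : ℤ))).map f a) b =
      (tateCohomologyFunctor n).map (f ▷ B) (cupNeg p A B q n h a b) := by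
  induction p generalizing A A' n with
  | zero =>
    obtain rfl : q = n := by simpa using h
    exact cupZero_map B f q a b
  | succ p ih =>
    have hm : -(p : ℤ) + q = n + 1 := by push_cast at h; omega
    apply ((ConcreteCategory.isIso_iff_bijective (downIso (A' ⊗ B) n (n + 1) rfl).hom).1
      inferInstance).1
    rw [downIso_cupNeg_succ p A' B q n (n + 1) h hm, downIso_naturality_apply,
      downIso_naturality_apply, ih,
      downIso_cupNeg_succ p A B q n (n + 1) h hm,
      ← tate_map_comp_apply, ← tate_map_comp_apply, associator_naturality_middle]

theorem cup_map {A A' : Rep k G} (B : Rep k G) (f : A ⟶ A') {p q n : ℤ} (h : p + q = n)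
    (a : tateCohomology A p) (b : tateCohomology B q) :
    cup h ((tateCohomologyFunctor p).map f a) b =
      (tateCohomologyFunctor n).map (f ▷ B) (cup h a b) := by
  match p, h, a with
  | .ofNat p, h, a => exact cupNat_map p B f q n h a b
  | .negSucc p, h, a => exact cupNeg_map (p + 1) B f q n h a b

/-! ### The cup product and connecting homomorphisms -/

theorem cup_eq_cupNeg (p : ℕ) {A B : Rep k G} {q n : ℤ} (h : -(p : ℤ) + q = n) :
    cup (A := A) (B := B) h = cupNeg p A B q n h := by
  cases p <;> rfl

/-- The connecting homomorphism of a `k`-split sequence tensored with `B`. -/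
def tensorConnecting {S : ShortComplex (Rep k G)} (σ : LinearSplitting S) (B : Rep k G)
    (n n' : ℤ) (hn : n + 1 = n') : tateCohomology (S.X₃ ⊗ B) n ⟶ tateCohomology (S.X₁ ⊗ B) n' :=
  connecting (σ.tensorRight B).shortExact n n' hn

theorem tensorConnecting_eq_upIso {S : ShortComplex (Rep k G)} (σ : LinearSplitting S)
    (B : Rep k G) (t₂ : S.X₂ ⟶ Rep.leftRegular k G ⊗ S.X₁) (t₃ : S.X₃ ⟶ normCoker k G ⊗ S.X₁)
    (h₁₂ : S.f ≫ t₂ = (λ_ S.X₁).inv ≫ normElt k G ▷ S.X₁)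
    (h₂₃ : t₂ ≫ normCokerProj k G ▷ S.X₁ = S.g ≫ t₃) (n n' : ℤ) (hn : n + 1 = n') :
    tensorConnecting σ B n n' hn =
      (tateCohomologyFunctor n).map (t₃ ▷ B ≫ (α_ (normCoker k G) S.X₁ B).hom) ≫
        (upIso (S.X₁ ⊗ B) n n' hn).hom := by
  have e₁₂ : (λ_ (S.X₁ ⊗ B)).inv ≫ normElt k G ▷ (S.X₁ ⊗ B) =
      S.f ▷ B ≫ t₂ ▷ B ≫ (α_ _ _ _).hom := by
    rw [← comp_whiskerRight_assoc, h₁₂]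
    monoidal
  have e₂₃ : (t₂ ▷ B ≫ (α_ _ _ _).hom) ≫ normCokerProj k G ▷ (S.X₁ ⊗ B) =
      S.g ▷ B ≫ t₃ ▷ B ≫ (α_ _ _ _).hom := by
    rw [← comp_whiskerRight_assoc, ← h₂₃]
    monoidal
  exact connecting_eq_upIso (σ.tensorRight B).shortExact _ _ e₁₂ e₂₃ n n' hn

theorem tensorConnecting_eq_downIso {S : ShortComplex (Rep k G)} (σ : LinearSplitting S)
    (B : Rep k G) (t₁ : augKer k G ⊗ S.X₃ ⟶ S.X₁) (t₂ : Rep.leftRegular k G ⊗ S.X₃ ⟶ S.X₂)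
    (h₁₂ : t₁ ≫ S.f = augKerIncl k G ▷ S.X₃ ≫ t₂)
    (h₂₃ : t₂ ≫ S.g = aug k G ▷ S.X₃ ≫ (λ_ S.X₃).hom) (n n' : ℤ) (hn : n + 1 = n') :
    tensorConnecting σ B n n' hn = (downIso (S.X₃ ⊗ B) n n' hn).hom ≫
      (tateCohomologyFunctor n').map ((α_ (augKer k G) S.X₃ B).inv ≫ t₁ ▷ B) := by
  have e₁₂ : ((α_ _ _ _).inv ≫ t₁ ▷ B) ≫ S.f ▷ B =
      augKerIncl k G ▷ (S.X₃ ⊗ B) ≫ (α_ _ _ _).inv ≫ t₂ ▷ B := by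
    rw [Category.assoc, ← comp_whiskerRight, h₁₂]
    monoidal
  have e₂₃ : ((α_ _ _ _).inv ≫ t₂ ▷ B) ≫ S.g ▷ B =
      aug k G ▷ (S.X₃ ⊗ B) ≫ (λ_ (S.X₃ ⊗ B)).hom := by
    rw [Category.assoc, ← comp_whiskerRight, h₂₃]
    monoidal
  exact connecting_eq_downIso (σ.tensorRight B).shortExact _ _ e₁₂ e₂₃ n n' hn

theorem cupNat_connecting {S : ShortComplex (Rep k G)} (σ : LinearSplitting S) (B : Rep k G)
    (p : ℕ) {q n n' : ℤ} (hp : (p : ℤ) + 1 = (p + 1 : ℕ)) (hn : n + 1 = n') (h : (p : ℤ) + q = n)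
    (h' : ((p + 1 : ℕ) : ℤ) + q = n') (a : tateCohomology S.X₃ p) (b : tateCohomology B q) :
    cupNat (p + 1) S.X₁ B q n' h' (connecting σ.shortExact p (p + 1 : ℕ) hp a) b =
      tensorConnecting σ B n n' hn (cupNat p S.X₃ B q n h a b) := by
  obtain ⟨t, ht⟩ := exists_toNormCoker σ
  rw [connecting_eq_upIso σ.shortExact _ t (f_toInduced σ).symm ht,
    tensorConnecting_eq_upIso σ B _ t (f_toInduced σ) ht, ModuleCat.comp_apply,
    ModuleCat.comp_apply, cupNat_succ_upIso p S.X₁ B q n n' h h' hn, cupNat_map,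
    tate_map_comp_apply]

theorem cupNeg_connecting {S : ShortComplex (Rep k G)} (σ : LinearSplitting S) (B : Rep k G)
    (p : ℕ) {q n n' : ℤ} (hp : -((p + 1 : ℕ) : ℤ) + 1 = -(p : ℤ)) (hn : n + 1 = n')
    (h : -((p + 1 : ℕ) : ℤ) + q = n) (h' : -(p : ℤ) + q = n')
    (a : tateCohomology S.X₃ (-((p + 1 : ℕ) : ℤ))) (b : tateCohomology B q) :
    cupNeg p S.X₁ B q n' h' (connecting σ.shortExact (-((p + 1 : ℕ) : ℤ)) (-(p : ℤ)) hp a) b =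
      tensorConnecting σ B n n' hn (cupNeg (p + 1) S.X₃ B q n h a b) := by
  obtain ⟨t, ht⟩ := exists_ofAugKer σ
  rw [connecting_eq_downIso σ.shortExact t _ ht (ofInduced_g σ),
    tensorConnecting_eq_downIso σ B t _ ht (ofInduced_g σ), ModuleCat.comp_apply,
    ModuleCat.comp_apply, downIso_cupNeg_succ p S.X₃ B q n n' h h' hn, cupNeg_map,
    ← tate_map_comp_apply, Iso.hom_inv_id_assoc]

/-- The rule `δ a ∪ b = δ (a ∪ b)` for `k`-split sequences. In degrees `p ≥ 0` of `a` the sequence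
is compared with the one of `upIso`, in degrees `p < 0` with the one of `downIso`; the rule then
becomes the recursion that defines the cup product. -/
theorem cup_connecting {S : ShortComplex (Rep k G)} (σ : LinearSplitting S) (B : Rep k G)
    {p p' q n n' : ℤ} (hp : p + 1 = p') (hn : n + 1 = n') (h : p + q = n) (h' : p' + q = n')
    (a : tateCohomology S.X₃ p) (b : tateCohomology B q) :
    cup h' (connecting σ.shortExact p p' hp a) b =
      tensorConnecting σ B n n' hn (cup h a b) := by
  match p, hp, h, a with
  | .ofNat p, hp, h, a =>
    obtain rfl : p' = (p + 1 : ℕ) := hp.symm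
    exact cupNat_connecting σ B p hp hn h h' a b
  | .negSucc p, hp, h, a =>
    obtain rfl : p' = -(p : ℤ) := by rw [← hp, Int.negSucc_eq]; ring
    rw [cup_eq_cupNeg]
    exact cupNeg_connecting σ B p hp hn h h' a b

/-! ### The composition product -/

/-- The connecting homomorphism of a `k`-split sequence to which `Homₖ(X, -)` is applied. -/
def homConnecting {S : ShortComplex (Rep k G)} (σ : LinearSplitting S) (X : Rep k G) (i j : ℤ)
    (hij : i + 1 = j) : tateCohomology (homRep X S.X₃) i ⟶ tateCohomology (homRep X S.X₁) j :=
  connecting (σ.hom X).shortExact i j hij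

theorem homConnecting_naturality {S T : ShortComplex (Rep k G)} (σ : LinearSplitting S)
    (τ : LinearSplitting T) (F : S ⟶ T) (X : Rep k G) (i j : ℤ) (hij : i + 1 = j) :
    homConnecting σ X i j hij ≫ (homCohomology X j).map F.τ₁ =
      (homCohomology X i).map F.τ₃ ≫ homConnecting τ X i j hij :=
  connecting_naturality (σ.hom X).shortExact (τ.hom X).shortExact
    ((homFunctor X).mapShortComplex.map F) i j hij

omit [Fintype G] in
theorem compHom_naturality (X Y : Rep k G) {Z Z' : Rep k G} (f : Z ⟶ Z') :
    (homFunctor Y).map f ▷ homRep X Y ≫ compHom X Y Z' =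
      compHom X Y Z ≫ (homFunctor X).map f := by
  refine Rep.hom_ext (Representation.IntertwiningMap.ext (TensorProduct.ext' fun a b => ?_))
  rfl

theorem cupComp_map {X Y Z Z' : Rep k G} (f : Z ⟶ Z') {p q n : ℤ} (h : p + q = n)
    (a : tateCohomology (homRep Y Z) p) (b : tateCohomology (homRep X Y) q) :
    cupComp h ((homCohomology Y p).map f a) b = (homCohomology X n).map f (cupComp h a b) := by
  refine (congrArg ((tateCohomologyFunctor n).map (compHom X Y Z'))
    (cup_map (homRep X Y) ((homFunctor Y).map f) h a b)).trans ?_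
  rw [← tate_map_comp_apply, compHom_naturality, tate_map_comp_apply]
  rfl

theorem cupComp_add_left {X Y Z : Rep k G} {p q n : ℤ} (h : p + q = n)
    (a a' : tateCohomology (homRep Y Z) p) (b : tateCohomology (homRep X Y) q) :
    cupComp h (a + a') b = cupComp h a b + cupComp h a' b := by
  simp [cupComp]

/-- The rule `δ a ∪ b = δ (a ∪ b)` for the composition product. -/
theorem cupComp_connecting {S : ShortComplex (Rep k G)} (σ : LinearSplitting S) {X Y : Rep k G}
    {p p' q n n' : ℤ} (hp : p + 1 = p') (hn : n + 1 = n') (h : p + q = n) (h' : p' + q = n')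
    (a : tateCohomology (homRep Y S.X₃) p) (b : tateCohomology (homRep X Y) q) :
    cupComp h' (homConnecting σ Y p p' hp a) b = homConnecting σ X n n' hn (cupComp h a b) := by
  refine (congrArg ((tateCohomologyFunctor n').map (compHom X Y S.X₁))
    (cup_connecting (σ.hom Y) (homRep X Y) hp hn h h' a b)).trans ?_
  exact connecting_naturality_apply ((σ.hom Y).tensorRight (homRep X Y)).shortExact
    (σ.hom X).shortExact
    { τ₁ := compHom X Y S.X₁, τ₂ := compHom X Y S.X₂, τ₃ := compHom X Y S.X₃
      comm₁₂ := (compHom_naturality X Y S.f).symm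
      comm₂₃ := (compHom_naturality X Y S.g).symm } n n' hn (cup h a b)

/-- The class `[f] ∈ Ĥ⁰(G, Homₖ(X, Y))` of a map of `G`-modules. -/
def homClass {X Y : Rep k G} (f : X ⟶ Y) : tateCohomology (homRep X Y) 0 :=
  tateClass (homRep X Y) ⟨f.hom.toLinearMap, fun g => LinearMap.ext fun x => by
    change Y.ρ g (f.hom (X.ρ g⁻¹ x)) = f.hom x
    rw [← Rep.hom_comm_apply]
    simp⟩

theorem homClass_surjective {X Y : Rep k G} (a : tateCohomology (homRep X Y) 0) :
    ∃ f : X ⟶ Y, homClass f = a := by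
  obtain ⟨⟨φ, hφ⟩, rfl⟩ := tateClass_surjective _ a
  refine ⟨Rep.ofHom ⟨φ, fun g => LinearMap.ext fun x => ?_⟩, rfl⟩
  have := LinearMap.congr_fun (hφ g) (X.ρ g x)
  change Y.ρ g ((show X.V →ₗ[k] Y.V from φ) (X.ρ g⁻¹ (X.ρ g x))) = _ at this
  simp at this
  exact this.symm

theorem map_idClass {X Y : Rep k G} (f : X ⟶ Y) :
    (homCohomology X 0).map f (idClass X) = homClass f :=
  map_tateClass ((homFunctor X).map f) _ _ rfl

theorem homClass_id (X : Rep k G) : homClass (𝟙 X) = idClass X := rfl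

theorem cupComp_homClass {X Y Z : Rep k G} (f : Y ⟶ Z) {q : ℤ} (h : 0 + q = q)
    (b : tateCohomology (homRep X Y) q) :
    cupComp h (homClass f) b = (homCohomology X q).map f b := by
  refine (congrArg ((tateCohomologyFunctor q).map (compHom X Y Z))
    (cupZero_tateClass (homRep Y Z) (homRep X Y) q _ b)).trans ?_
  rw [← tate_map_comp_apply]
  rfl

theorem idClass_cupComp {X Y : Rep k G} {q : ℤ} (h : 0 + q = q)
    (b : tateCohomology (homRep X Y) q) : cupComp h (idClass Y) b = b := by
  rw [← homClass_id, cupComp_homClass, CategoryTheory.Functor.map_id]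
  rfl

/-! ### Dimension shifting for `Homₖ(X, -)` -/

/-- The identity of `k[G] ⊗ M` is `∑ g, g ∘ φ ∘ g⁻¹`, for the projection `φ` onto `k 1 ⊗ M`. -/
theorem exists_sum_conj_eq_id (M : Rep k G) :
    ∃ φ : (Rep.leftRegular k G ⊗ M).V →ₗ[k] (Rep.leftRegular k G ⊗ M).V,
      ∀ a, a = ∑ g : G, (Rep.leftRegular k G ⊗ M).ρ g (φ ((Rep.leftRegular k G ⊗ M).ρ g⁻¹ a)) := by
  classical
  let p : (Rep.leftRegular k G).V →ₗ[k] (Rep.leftRegular k G).V :=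
    MonoidAlgebra.lsingle (R := k) 1 ∘ₗ coeffOne k G
  have hp : ∑ g : G, (Rep.leftRegular k G).ρ g ∘ₗ p ∘ₗ (Rep.leftRegular k G).ρ g⁻¹
      = LinearMap.id := by
    ext h : 2
    simp [p, coeffOne, Finsupp.single_apply, inv_mul_eq_one]
    rw [Finset.sum_eq_single h (fun g _ hg => by simp [hg]) (by simp)]
    simp
  have h : ∑ g : G, (Rep.leftRegular k G ⊗ M).ρ g ∘ₗ p.rTensor M.V ∘ₗ
      (Rep.leftRegular k G ⊗ M).ρ g⁻¹ = LinearMap.id := by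
    refine TensorProduct.ext' fun x m => ?_
    refine Eq.trans ?_ (congrArg (fun y => TensorProduct.tmul k y m) (LinearMap.congr_fun hp x))
    simp only [LinearMap.sum_apply, TensorProduct.sum_tmul]
    refine Finset.sum_congr rfl fun g _ => ?_
    simp
  refine ⟨p.rTensor M.V, fun a => ?_⟩
  have := LinearMap.congr_fun h a
  simp only [LinearMap.sum_apply] at this
  exact this.symm

/-- The module `Homₖ(X, k[G] ⊗ M)` is cohomologically trivial. -/
theorem isZero_tate_hom_induced (X M : Rep k G) (n : ℤ) :
    Limits.IsZero (tateCohomology (homRep X (Rep.leftRegular k G ⊗ M)) n) := by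
  rw [Limits.IsZero.iff_id_eq_zero, ← (tateCohomologyFunctor n).map_id]
  obtain ⟨φ, hφ⟩ := exists_sum_conj_eq_id M
  refine map_eq_zero_of_norm _ (LinearMap.llcomp k X.V _ _ φ) (fun a => ?_) n
  let a' : X.V →ₗ[k] (Rep.leftRegular k G ⊗ M).V := a
  refine LinearMap.ext fun x => (hφ (a' x)).trans ?_
  refine Eq.trans ?_ (LinearMap.sum_apply (M₂ := (Rep.leftRegular k G ⊗ M).V) _ _ x).symm
  refine Finset.sum_congr rfl fun g _ => ?_
  change _ = (Rep.leftRegular k G ⊗ M).ρ g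
    (φ ((Rep.leftRegular k G ⊗ M).ρ g⁻¹ (a' (X.ρ g⁻¹⁻¹ (X.ρ g⁻¹ x)))))
  simp

/-- The sequence `M ⟶ k[G] ⊗ M ⟶ (k[G]/k N) ⊗ M`. -/
def upShift (M : Rep k G) : ShortComplex (Rep k G) where
  X₁ := M
  X₂ := Rep.leftRegular k G ⊗ M
  X₃ := normCoker k G ⊗ M
  f := (λ_ M).inv ≫ normElt k G ▷ M
  g := normCokerProj k G ▷ M
  zero := by
    rw [Category.assoc, ← comp_whiskerRight, normElt_comp_normCokerProj,
      MonoidalPreadditive.zero_whiskerRight, Limits.comp_zero]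

/-- The sequence `I_G ⊗ M ⟶ k[G] ⊗ M ⟶ M`. -/
def downShift (M : Rep k G) : ShortComplex (Rep k G) where
  X₁ := augKer k G ⊗ M
  X₂ := Rep.leftRegular k G ⊗ M
  X₃ := M
  f := augKerIncl k G ▷ M
  g := aug k G ▷ M ≫ (λ_ M).hom
  zero := by
    rw [← Category.assoc, ← comp_whiskerRight, augKerIncl_comp_aug,
      MonoidalPreadditive.zero_whiskerRight, Limits.zero_comp]

/-- The splitting of `upShift M` induced by `upSeqSplitting`. -/
def upShiftSplitting (M : Rep k G) : LinearSplitting (upShift M) :=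
  let σ := (upSeqSplitting k G).tensorRight M
  LinearSplitting.mk ((λ_ M).hom.hom.toLinearMap ∘ₗ σ.r) σ.s
    (fun x => (congrArg (λ_ M).hom.hom (σ.r_f ((λ_ M).inv.hom x))).trans
      (Rep.hom_inv_apply _ _ (λ_ M) x))
    σ.g_s
    (fun x => by
      refine Eq.trans ?_ (σ.f_r_add_s_g x)
      exact congrArg (fun y : (Rep.leftRegular k G ⊗ M).V =>
          y + (show (Rep.leftRegular k G ⊗ M).V from σ.s ((normCokerProj k G ▷ M).hom x)))
        (congrArg (normElt k G ▷ M).hom (Rep.inv_hom_apply _ _ (λ_ M) (σ.r x))))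

/-- The splitting of `downShift M` induced by `downSeqSplitting`. -/
def downShiftSplitting (M : Rep k G) : LinearSplitting (downShift M) :=
  let σ := (downSeqSplitting k G).tensorRight M
  LinearSplitting.mk σ.r (σ.s ∘ₗ (λ_ M).inv.hom.toLinearMap)
    σ.r_f
    (fun x => (congrArg (λ_ M).hom.hom (σ.g_s ((λ_ M).inv.hom x))).trans
      (Rep.hom_inv_apply _ _ (λ_ M) x))
    (fun x => by
      refine Eq.trans ?_ (σ.f_r_add_s_g x)
      exact congrArg (fun y : (Rep.leftRegular k G ⊗ M).V =>
          (show (Rep.leftRegular k G ⊗ M).V from (augKerIncl k G ▷ M).hom (σ.r x)) + y)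
        (congrArg σ.s (Rep.inv_hom_apply _ _ (λ_ M) ((aug k G ▷ M).hom x))))

/-- The connecting isomorphism `Ĥⁱ(G, Homₖ(X, (k[G]/k N) ⊗ M)) ⟶ Ĥⁱ⁺¹(G, Homₖ(X, M))`. -/
def homUp (X M : Rep k G) (i j : ℤ) (hij : i + 1 = j) :
    tateCohomology (homRep X (normCoker k G ⊗ M)) i ⟶ tateCohomology (homRep X M) j :=
  homConnecting (upShiftSplitting M) X i j hij

/-- The connecting isomorphism `Ĥⁱ(G, Homₖ(X, M)) ⟶ Ĥⁱ⁺¹(G, Homₖ(X, I_G ⊗ M))`. -/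
def homDown (X M : Rep k G) (i j : ℤ) (hij : i + 1 = j) :
    tateCohomology (homRep X M) i ⟶ tateCohomology (homRep X (augKer k G ⊗ M)) j :=
  homConnecting (downShiftSplitting M) X i j hij

instance isIso_homUp (X M : Rep k G) (i j : ℤ) (hij : i + 1 = j) : IsIso (homUp X M i j hij) :=
  ShortComplex.ShortExact.isIso_δ _ i j hij (isZero_tate_hom_induced X M i)
    (isZero_tate_hom_induced X M j)

instance isIso_homDown (X M : Rep k G) (i j : ℤ) (hij : i + 1 = j) :
    IsIso (homDown X M i j hij) :=
  ShortComplex.ShortExact.isIso_δ _ i j hij (isZero_tate_hom_induced X M i)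
    (isZero_tate_hom_induced X M j)

theorem homUp_bijective (X M : Rep k G) (i j : ℤ) (hij : i + 1 = j) :
    Function.Bijective (homUp X M i j hij) :=
  (ConcreteCategory.isIso_iff_bijective _).1 inferInstance

theorem homDown_bijective (X M : Rep k G) (i j : ℤ) (hij : i + 1 = j) :
    Function.Bijective (homDown X M i j hij) :=
  (ConcreteCategory.isIso_iff_bijective _).1 inferInstance

theorem cupComp_homUp {X Y Z : Rep k G} {p p' q n n' : ℤ} (hp : p + 1 = p') (hn : n + 1 = n')
    (h : p + q = n) (h' : p' + q = n') (a : tateCohomology (homRep Y (normCoker k G ⊗ Z)) p)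
    (b : tateCohomology (homRep X Y) q) :
    cupComp h' (homUp Y Z p p' hp a) b = homUp X Z n n' hn (cupComp h a b) :=
  cupComp_connecting (upShiftSplitting Z) hp hn h h' a b

theorem cupComp_homDown {X Y Z : Rep k G} {p p' q n n' : ℤ} (hp : p + 1 = p') (hn : n + 1 = n')
    (h : p + q = n) (h' : p' + q = n') (a : tateCohomology (homRep Y Z) p)
    (b : tateCohomology (homRep X Y) q) :
    cupComp h' (homDown Y Z p p' hp a) b = homDown X Z n n' hn (cupComp h a b) :=
  cupComp_connecting (downShiftSplitting Z) hp hn h h' a b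

/-- The natural isomorphism `Ĥⁱ(G, Homₖ(X, (k[G]/k N) ⊗ -)) ≅ Ĥⁱ⁺¹(G, Homₖ(X, -))`. -/
def upShiftNatIso (X : Rep k G) (i j : ℤ) (hij : i + 1 = j) :
    tensorLeft (normCoker k G) ⋙ homCohomology X i ≅ homCohomology X j :=
  NatIso.ofComponents (fun M => asIso (homUp X M i j hij)) fun {M N} f =>
    have h : (λ_ M).inv ≫ normElt k G ▷ M ≫ Rep.leftRegular k G ◁ f =
        f ≫ (λ_ N).inv ≫ normElt k G ▷ N := by
      rw [← whisker_exchange, leftUnitor_inv_naturality_assoc]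
    (homConnecting_naturality (upShiftSplitting M) (upShiftSplitting N)
      { τ₁ := f
        τ₂ := Rep.leftRegular k G ◁ f
        τ₃ := normCoker k G ◁ f
        comm₁₂ := h.symm.trans (Category.assoc _ _ _).symm
        comm₂₃ := whisker_exchange _ _ } X i j hij).symm

/-- The natural isomorphism `Ĥⁱ(G, Homₖ(X, -)) ≅ Ĥⁱ⁺¹(G, Homₖ(X, I_G ⊗ -))`. -/
def downShiftNatIso (X : Rep k G) (i j : ℤ) (hij : i + 1 = j) :
    homCohomology X i ≅ tensorLeft (augKer k G) ⋙ homCohomology X j :=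
  NatIso.ofComponents (fun M => asIso (homDown X M i j hij)) fun {M N} f =>
    have h : Rep.leftRegular k G ◁ f ≫ aug k G ▷ N ≫ (λ_ N).hom =
        aug k G ▷ M ≫ (λ_ M).hom ≫ f := by
      rw [whisker_exchange_assoc, leftUnitor_naturality]
    (homConnecting_naturality (downShiftSplitting M) (downShiftSplitting N)
      { τ₁ := augKer k G ◁ f
        τ₂ := Rep.leftRegular k G ◁ f
        τ₃ := f
        comm₁₂ := whisker_exchange _ _
        comm₂₃ := h.trans (Category.assoc _ _ _).symm } X i j hij).symm

/-- Induction for classes in `Ĥᵖ(G, Homₖ(Y, Z))`, for all `Z` and `p`: the property is shown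
for the classes of maps of `G`-modules, and transported along the two dimension shifts. -/
theorem homCohomology_induction {Y : Rep k G}
    {P : ∀ (Z : Rep k G) (p : ℤ), tateCohomology (homRep Y Z) p → Prop}
    (zero : ∀ (Z : Rep k G) (f : Y ⟶ Z), P Z 0 (homClass f))
    (up : ∀ (Z : Rep k G) (p p' : ℤ) (hp : p + 1 = p')
      (a : tateCohomology (homRep Y (normCoker k G ⊗ Z)) p), P (normCoker k G ⊗ Z) p a →
      P Z p' (homUp Y Z p p' hp a))
    (down : ∀ (Z : Rep k G) (p p' : ℤ) (hp : p + 1 = p') (a : tateCohomology (homRep Y Z) p),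
      P (augKer k G ⊗ Z) p' (homDown Y Z p p' hp a) → P Z p a)
    (Z : Rep k G) (p : ℤ) (a : tateCohomology (homRep Y Z) p) : P Z p a := by
  induction p using Int.induction_on generalizing Z with
  | zero =>
    obtain ⟨f, rfl⟩ := homClass_surjective a
    exact zero Z f
  | succ i ih =>
    obtain ⟨a, rfl⟩ := (homUp_bijective Y Z i (i + 1) rfl).2 a
    exact up Z _ _ rfl a (ih _ a)
  | pred i ih =>
    exact down Z _ (-(i : ℤ)) (by ring) a (ih _ _)

/-! ### Associativity and units -/

theorem cupComp_assoc {W X Y : Rep k G} {q s l : ℤ} (hqs : q + s = l)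
    (b : tateCohomology (homRep X Y) q) (c : tateCohomology (homRep W X) s) (Z : Rep k G) (p : ℤ)
    (a : tateCohomology (homRep Y Z) p) : ∀ {m n : ℤ} (hpq : p + q = m) (hms : m + s = n)
      (hpl : p + l = n),
    cupComp hms (cupComp hpq a b) c = cupComp hpl a (cupComp hqs b c) := by
  induction Z, p, a using homCohomology_induction with
  | zero Z f =>
    intro m n hpq hms hpl
    obtain rfl : q = m := by omega
    obtain rfl : l = n := by omega
    rw [cupComp_homClass, cupComp_homClass, cupComp_map]
  | up Z p p' hp a ih =>
    intro m n hpq hms hpl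
    have hpq' : p + q = m - 1 := by omega
    have hms' : m - 1 + s = n - 1 := by omega
    have hpl' : p + l = n - 1 := by omega
    rw [cupComp_homUp hp (sub_add_cancel m 1) hpq' hpq,
      cupComp_homUp _ (sub_add_cancel n 1) hms' hms,
      cupComp_homUp hp (sub_add_cancel n 1) hpl' hpl]
    exact congrArg _ (ih hpq' hms' hpl')
  | down Z p p' hp a ih =>
    intro m n hpq hms hpl
    have hpq' : p' + q = m + 1 := by omega
    have hms' : m + 1 + s = n + 1 := by omega
    have hpl' : p' + l = n + 1 := by omega
    apply (homDown_bijective W Z n (n + 1) rfl).1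
    rw [← cupComp_homDown rfl rfl hms hms',
      ← cupComp_homDown hp rfl hpq hpq',
      ← cupComp_homDown hp rfl hpl hpl']
    exact ih hpq' hms' hpl'

theorem cupComp_idClass {Y : Rep k G} (Z : Rep k G) (p : ℤ) (a : tateCohomology (homRep Y Z) p) :
    cupComp (add_zero p) a (idClass Y) = a := by
  induction Z, p, a using homCohomology_induction with
  | zero Z f => rw [cupComp_homClass, map_idClass]
  | up Z p p' hp a ih =>
    rw [cupComp_homUp hp hp (add_zero p)]
    exact congrArg _ ih
  | down Z p p' hp a ih =>
    apply (homDown_bijective Y Z p p' hp).1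
    rw [← cupComp_homDown hp hp (add_zero p) (add_zero p')]
    exact ih

/-- If `a ↦ a ∪ x` is bijective on `Ĥ⁰`, it is bijective on `Ĥⁱ` for all `i`. -/
theorem cupComp_bijective {X X' : Rep k G} {r : ℤ} (x : tateCohomology (homRep X' X) r)
    (h0 : ∀ Z : Rep k G, Function.Bijective
      fun a : tateCohomology (homRep X Z) 0 => cupComp (zero_add r) a x)
    (i : ℤ) : ∀ (n : ℤ) (h : i + r = n) (Z : Rep k G), Function.Bijective
      fun a : tateCohomology (homRep X Z) i => cupComp h a x := by
  induction i using Int.induction_on with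
  | zero =>
    intro n h Z
    obtain rfl : r = n := by omega
    exact h0 Z
  | succ i ih =>
    intro n h Z
    have h' : (i : ℤ) + r = n - 1 := by omega
    have := (homUp_bijective X' Z (n - 1) n (sub_add_cancel n 1)).comp
      (ih (n - 1) h' (normCoker k G ⊗ Z))
    refine (Function.Bijective.of_comp_iff _ (homUp_bijective X Z i (i + 1) rfl)).1 ?_
    convert this using 1
    exact funext fun a => cupComp_homUp rfl _ h' h a x
  | pred i ih =>
    intro n h Z
    have h' : -(i : ℤ) + r = n + 1 := by omega
    have := (ih (n + 1) h' (augKer k G ⊗ Z)).comp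
      (homDown_bijective X Z (-i - 1) (-i) (sub_add_cancel _ 1))
    refine (Function.Bijective.of_comp_iff' (homDown_bijective X' Z n (n + 1) rfl) _).1 ?_
    convert this using 1
    exact funext fun a => (cupComp_homDown (sub_add_cancel _ 1) rfl h h' a x).symm

/-! ### Encoding pairs -/

/-- A natural isomorphism in one degree gives one in degree `0`, by dimension shifting. -/
theorem nonempty_iso_zero (X X' : Rep k G) (r i : ℤ) :
    Nonempty (homCohomology X i ≅ homCohomology X' (i + r)) →
      Nonempty (homCohomology X 0 ≅ homCohomology X' r) := by
  induction i using Int.induction_on with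
  | zero => rw [zero_add]; exact id
  | succ i ih =>
    rintro ⟨e⟩
    exact ih ⟨downShiftNatIso X i (i + 1) rfl ≪≫ Functor.isoWhiskerLeft _ e ≪≫
      (downShiftNatIso X' (i + r) (i + 1 + r) (by ring)).symm⟩
  | pred i ih =>
    rintro ⟨e⟩
    exact ih ⟨(upShiftNatIso X (-i - 1) (-i) (by ring)).symm ≪≫ Functor.isoWhiskerLeft _ e ≪≫
      upShiftNatIso X' (-i - 1 + r) (-i + r) (by ring)⟩

/-- The Yoneda argument: a natural isomorphism in degree `0` is `a ↦ a ∪ x`, where `x` is the image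
of the class of the identity. -/
theorem exists_cupComp_bijective {X X' : Rep k G} {r : ℤ}
    (e : homCohomology X 0 ≅ homCohomology X' r) :
    ∃ x : tateCohomology (homRep X' X) r, ∀ Z : Rep k G, Function.Bijective
      fun a : tateCohomology (homRep X Z) 0 => cupComp (zero_add r) a x := by
  refine ⟨e.hom.app X (idClass X), fun Z => ?_⟩
  have : (fun a : tateCohomology (homRep X Z) 0 =>
      cupComp (zero_add r) a (e.hom.app X (idClass X))) = e.hom.app Z := by
    funext a
    obtain ⟨f, rfl⟩ := homClass_surjective a
    rw [cupComp_homClass, ← map_idClass]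
    exact congrArg (fun φ => φ.hom (idClass X)) (e.hom.naturality f).symm
  rw [this]
  exact (ConcreteCategory.isIso_iff_bijective (e.hom.app Z)).1 inferInstance

/-- A class `x` with a two-sided inverse `x'` gives bijections `a ↦ a ∪ x`. -/
theorem cupComp_bijective_of_inverse {X X' : Rep k G} {r : ℤ} {x : tateCohomology (homRep X' X) r}
    {x' : tateCohomology (homRep X X') (-r)}
    (h : cupComp (neg_add_cancel r) x' x = idClass X')
    (h' : cupComp (add_neg_cancel r) x x' = idClass X) (i : ℤ) (Z : Rep k G) :
    Function.Bijective fun a : tateCohomology (homRep X Z) i => cupComp (n := i + r) rfl a x := by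
  refine Function.bijective_iff_has_inverse.2
    ⟨fun b => cupComp (add_neg_cancel_right i r) b x', fun a => ?_, fun b => ?_⟩
  · change cupComp (add_neg_cancel_right i r) (cupComp rfl a x) x' = a
    rw [cupComp_assoc (add_neg_cancel r) x x' Z i a rfl _ (add_zero i), h', cupComp_idClass]
  · change cupComp rfl (cupComp (add_neg_cancel_right i r) b x') x = b
    rw [cupComp_assoc (neg_add_cancel r) x' x Z _ b _ rfl (add_zero _), h, cupComp_idClass]

/-- If all `a ↦ a ∪ x` are bijective, `x` has a two-sided inverse. -/
theorem exists_inverse {X X' : Rep k G} {r : ℤ} (x : tateCohomology (homRep X' X) r)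
    (hx : ∀ (i n : ℤ) (h : i + r = n) (Z : Rep k G), Function.Bijective
      fun a : tateCohomology (homRep X Z) i => cupComp h a x) :
    ∃ x' : tateCohomology (homRep X X') (-r), cupComp (neg_add_cancel r) x' x = idClass X' ∧
      cupComp (add_neg_cancel r) x x' = idClass X := by
  obtain ⟨x', hx'⟩ := (hx (-r) 0 (neg_add_cancel r) X').2 (idClass X')
  -- `x ∪ x'` and `[id_X]` agree after `∪ x`: both give `x`.
  refine ⟨x', hx', (hx 0 r (zero_add r) X).1 ?_⟩
  change cupComp _ (cupComp _ x x') x = cupComp _ (idClass X) x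
  rw [cupComp_assoc (neg_add_cancel r) x' x X r x (add_neg_cancel r) (zero_add r) (add_zero r),
    idClass_cupComp]
  exact (congrArg (cupComp (add_zero r) x) hx').trans (cupComp_idClass X r x)

end TateCup

end

theorem proposition3p1 {G : Type} [Group G] [Fintype G] (X X' : Rep.{0} ℤ G) (r : ℤ) :
    List.TFAE [
      TateCup.IsEncodingPair r X X',
      ∃ x : tateCohomology (TateCup.homRep X' X) r, ∀ i : ℤ,
        ∃ e : TateCup.homCohomology X i ≅ TateCup.homCohomology X' (i + r),
          ∀ (A : Rep.{0} ℤ G) (a : tateCohomology (TateCup.homRep X A) i),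
            (e.hom.app A).hom a = TateCup.cupComp (n := i + r) rfl a x,
      ∃ (x : tateCohomology (TateCup.homRep X' X) r)
        (x' : tateCohomology (TateCup.homRep X X') (-r)),
        TateCup.cupComp (neg_add_cancel r) x' x = TateCup.idClass X' ∧
          TateCup.cupComp (add_neg_cancel r) x x' = TateCup.idClass X] := by
  tfae_have 2 → 1 := fun ⟨_, hx⟩ => ⟨0, ⟨(hx 0).choose⟩⟩
  tfae_have 1 → 3 := by
    rintro ⟨i, he⟩
    obtain ⟨e⟩ := TateCup.nonempty_iso_zero X X' r i he
    obtain ⟨x, hx⟩ := TateCup.exists_cupComp_bijective e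
    exact ⟨x, TateCup.exists_inverse x (TateCup.cupComp_bijective x hx)⟩
  tfae_have 3 → 2 := by
    rintro ⟨x, x', h, h'⟩
    refine ⟨x, fun i => ?_⟩
    let φ : ∀ A : Rep.{0} ℤ G, (TateCup.homCohomology X i).obj A ⟶
        (TateCup.homCohomology X' (i + r)).obj A := fun A => ModuleCat.ofHom
      { toFun := fun a => TateCup.cupComp (n := i + r) rfl a x
        map_add' := fun a a' => TateCup.cupComp_add_left rfl a a' x
        map_smul' := fun c a =>
          map_intCast_smul (AddMonoidHom.mk'
            (fun a : tateCohomology (TateCup.homRep X A) i => TateCup.cupComp (n := i + r) rfl a x)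
            fun a a' => TateCup.cupComp_add_left rfl a a' x) ℤ ℤ c a }
    have hφ : ∀ A, IsIso (φ A) := fun A => (ConcreteCategory.isIso_iff_bijective (φ A)).2
      (TateCup.cupComp_bijective_of_inverse h h' i A)
    exact ⟨NatIso.ofComponents (fun A => @asIso _ _ _ _ (φ A) (hφ A)) fun {A B} f => by
      ext a
      exact TateCup.cupComp_map f rfl a x, fun A a => rfl⟩
  tfae_finish
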